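/- Fix integers $n,q\ge 1$, $p\ge 0$ and a design matrix $X\in\mathbb R^{p\times n}$ (rows are predictors, columns are observations). For $M\subseteq\{1,\dots,p\}$ let $X_M$ be the matrix of the rows of $X$ with index in $M$; for $Y\in\mathbb R^{q\times n}$ and $X_MX_M^\top$ non-singular let $$\widehat B_M=YX_M^\top(X_MX_M^\top)^{-1},\quad H_M=X_M^\top(X_MX_M^\top)^{-1}X_M,\quad \widehat\Sigma_M=Y(I_n-H_M)Y^\top .$$ For a positive definite $S\in\mathbb R^{q\times q}$, $F\in\mathbb R^{q\times n}$ and $k\ge 1$ let $d_k(S,F)=\min_B\|S^{-1/2}(F-BX)\|_F^2$, the minimum being over all $B\in\mathbb R^{q\times p}$ with at most $k-1$ nonzero columns. For $\varepsilon>0$ and $B_M\in\mathbb R^{q\times|M|}$, where $|M|\ge 1$, put $$h_\varepsilon(B_M)=\mathrm I\{\tfrac12 d_{|M|}(\widehat\Sigma_M,B_MX_M)\ge\varepsilon\}\,\mathrm I\{|M|<n-q\}.$$ Let $\mathbb E(h_\varepsilon(B_M))$, a function of $Y$, be the expectation when $B_M$ has the generalized fiducial distribution given $Y$, that is, the matrix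 $t$-distribution on $\mathbb R^{q\times|M|}$ with $n-|M|-q+1$ degrees of freedom, mean $\widehat B_M$ and scale matrices $\widehat\Sigma_M$, $(X_MX_M^\top)^{-1}$, whose density at $B$ is proportional to $\det\big(I_q+\widehat\Sigma_M^{-1}(B-\widehat B_M)X_MX_M^\top(B-\widehat B_M)^\top\big)^{-n/2}$. **Theorem.** Let $q\ge1$ and $\alpha\in(0,1)$ be fixed. There is $n_0=n_0(q,\alpha)$ such that the following holds for all $n\ge n_0$, all $p$, all $X\in\mathbb R^{p\times n}$, all nonempty $M_o\subseteq\{1,\dots,p\}$, all $B^0\in\mathbb R^{q\times|M_o|}$, all positive definite $V^0\in\mathbb R^{q\times q}$, with smallest and largest eigenvalues $\underline\lambda_v,\bar\lambda_v$, and all $\varepsilon>0$. Let $\mathbb P_y$ be the law under which the columns of $Y-B^0X_{M_o}$ are independent $N(0,V^0)$ vectors. Assume that $X_{M_o}X_{M_o}^\top$ is non-singular, that $|M_o|<n^\alpha$, and that $$\varepsilon<\frac{1}{36q(n-|M_o|)}\,d_{|M_o|}(V^0,B^0X_{M_o}).$$ Then $$\mathbb P_y\Big[\mathbb E(h_\varepsilon(B_{M_o}))\ge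 1-\exp\Big(-\frac{\varepsilon(n-|M_o|)}{36}+\frac{q|M_o|}{2}\Big)-2\exp\Big(-\frac{(\sqrt{n-|M_o|}-2\sqrt q)^2}{8}\Big)\Big]\ge 1-V_{3,n},$$ where $$V_{3,n}=\exp\Big(-\frac{\varepsilon(n-|M_o|)\underline\lambda_v}{4\bar\lambda_v}+\frac{q|M_o|}{2}\Big)+e^{-0.04(n-|M_o|)}+e^{-0.15\,q(n-|M_o|)} .$$ -/

import Mathlib

open MeasureTheory ProbabilityTheory Matrix
open scoped MatrixOrder Kronecker ENNReal

/-- Lebesgue measure on real matrices, with one coordinate for each entry. -/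
noncomputable instance EAS.instMeasureSpaceMatrix {r m : Type*} [Fintype r] [Fintype m] :
    MeasureSpace (Matrix r m ℝ) :=
  inferInstanceAs (MeasureSpace (r → m → ℝ))

namespace EAS

section Matrices

variable {r m : Type*} [Fintype r] [Fintype m]

/-- The squared Frobenius norm of a real matrix. -/
def frobSq (A : Matrix r m ℝ) : ℝ := ∑ i, ∑ j, A i j ^ 2

/-- `S ^ (-1/2)`, the inverse of the positive semidefinite square root of `S`. -/
noncomputable def invSqrt [DecidableEq r] (S : Matrix r r ℝ) : Matrix r r ℝ := (CFC.sqrt S)⁻¹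

/-- The smallest eigenvalue of a symmetric matrix. -/
noncomputable def lambdaMin [DecidableEq r] {S : Matrix r r ℝ} (hS : S.IsHermitian) : ℝ :=
  ⨅ i, hS.eigenvalues i

/-- The largest eigenvalue of a symmetric matrix. -/
noncomputable def lambdaMax [DecidableEq r] {S : Matrix r r ℝ} (hS : S.IsHermitian) : ℝ :=
  ⨆ i, hS.eigenvalues i

/-- The law of a random matrix `Y` such that `vec Y` (the stacked columns) is Gaussian with mean
`vec A` and covariance matrix `V ⊗ U`; `U` is the covariance of the rows (within a column) and `V`
that of the columns. -/
noncomputable def matrixNormal [DecidableEq r] [DecidableEq m]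
    (A : Matrix r m ℝ) (U : Matrix r r ℝ) (V : Matrix m m ℝ) : Measure (Matrix r m ℝ) :=
  (multivariateGaussian (WithLp.toLp 2 (vec A)) (V ⊗ₖ U)).map
    (fun v => Matrix.of fun i j => v (j, i))

/-- The density of the matrix `t`-distribution `T(ν, A, S, W)` with respect to Lebesgue measure, up
to factors that do not depend on `T`. -/
noncomputable def matrixTKernel [DecidableEq r] [DecidableEq m] (ν : ℝ)
    (A : Matrix r m ℝ) (S : Matrix r r ℝ) (W : Matrix m m ℝ) (T : Matrix r m ℝ) : ℝ :=
  (1 + S⁻¹ * (T - A) * W⁻¹ * (T - A)ᵀ).det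
    ^ (-(ν + Fintype.card m + Fintype.card r - 1) / 2)

/-- The matrix `t`-distribution with `ν` degrees of freedom, mean `A` and scale matrices `S`, `W`:
the probability measure whose Lebesgue density is proportional to `matrixTKernel ν A S W`. -/
noncomputable def matrixT [DecidableEq r] [DecidableEq m] (ν : ℝ)
    (A : Matrix r m ℝ) (S : Matrix r r ℝ) (W : Matrix m m ℝ) : Measure (Matrix r m ℝ) :=
  (∫⁻ T, ENNReal.ofReal (matrixTKernel ν A S W T))⁻¹ •
    volume.withDensity fun T => ENNReal.ofReal (matrixTKernel ν A S W T)

end Matrices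

section Regression

variable {q n p : ℕ}

/-- The rows of the design matrix `X` (one row per predictor, one column per observation) whose
indices belong to `M`. -/
def rowsOf (X : Matrix (Fin p) (Fin n) ℝ) (M : Finset (Fin p)) : Matrix M (Fin n) ℝ :=
  X.submatrix Subtype.val id

/-- The Gram matrix `X_M X_Mᵀ`. -/
def gram (X : Matrix (Fin p) (Fin n) ℝ) (M : Finset (Fin p)) : Matrix M M ℝ :=
  rowsOf X M * (rowsOf X M)ᵀ

/-- The least squares estimator `Y X_Mᵀ (X_M X_Mᵀ)⁻¹`. -/
noncomputable def lsEstimator (X : Matrix (Fin p) (Fin n) ℝ) (M : Finset (Fin p))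
    (Y : Matrix (Fin q) (Fin n) ℝ) : Matrix (Fin q) M ℝ :=
  Y * (rowsOf X M)ᵀ * (gram X M)⁻¹

/-- The hat matrix `X_Mᵀ (X_M X_Mᵀ)⁻¹ X_M`. -/
noncomputable def hatMatrix (X : Matrix (Fin p) (Fin n) ℝ) (M : Finset (Fin p)) :
    Matrix (Fin n) (Fin n) ℝ :=
  (rowsOf X M)ᵀ * (gram X M)⁻¹ * rowsOf X M

/-- The residual sum of squares matrix `Y (I - H_M) Yᵀ`. -/
noncomputable def rss (X : Matrix (Fin p) (Fin n) ℝ) (M : Finset (Fin p))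
    (Y : Matrix (Fin q) (Fin n) ℝ) : Matrix (Fin q) (Fin q) ℝ :=
  Y * (1 - hatMatrix X M) * Yᵀ

/-- The objective `‖S ^ (-1/2) (F - B X)‖²` in the Frobenius norm. -/
noncomputable def objective (S : Matrix (Fin q) (Fin q) ℝ) (F : Matrix (Fin q) (Fin n) ℝ)
    (X : Matrix (Fin p) (Fin n) ℝ) (B : Matrix (Fin q) (Fin p) ℝ) : ℝ :=
  frobSq (invSqrt S * (F - B * X))

/-- `B` has at most `k - 1` nonzero columns (as an inequality of integers). -/
def IsFeasible (k : ℕ) (B : Matrix (Fin q) (Fin p) ℝ) : Prop :=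
  {j : Fin p | (fun i => B i j) ≠ 0}.ncard + 1 ≤ k

/-- `B` solves: minimise `‖S ^ (-1/2) (F - B X)‖²` over all coefficient matrices with at most
`k - 1` nonzero columns. -/
def IsSparseMin (S : Matrix (Fin q) (Fin q) ℝ) (F : Matrix (Fin q) (Fin n) ℝ)
    (X : Matrix (Fin p) (Fin n) ℝ) (k : ℕ) (B : Matrix (Fin q) (Fin p) ℝ) : Prop :=
  IsFeasible k B ∧
    ∀ B' : Matrix (Fin q) (Fin p) ℝ, IsFeasible k B' → objective S F X B ≤ objective S F X B'

open Classical in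
/-- The function `h_ε(B_M)`; it equals `1` when `B_M` is `ε`-admissible, and `0` otherwise. -/
noncomputable def hFun (ε : ℝ) (X : Matrix (Fin p) (Fin n) ℝ) (M : Finset (Fin p))
    (Y : Matrix (Fin q) (Fin n) ℝ) (BM : Matrix (Fin q) M ℝ) : ℝ :=
  if (∃ Bmin : Matrix (Fin q) (Fin p) ℝ,
        IsSparseMin (rss X M Y) (BM * rowsOf X M) X M.card Bmin ∧
        ε ≤ 1 / 2 * objective (rss X M Y) (BM * rowsOf X M) X Bmin) ∧
      M.card + q < n
  then 1 else 0

/-- The generalized fiducial distribution of `B_M` given the data `Y`: the matrix `t`-distribution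
`T(n - |M| - q + 1, B̂_M, Σ̂_M, (X_M X_Mᵀ)⁻¹)`. -/
noncomputable def fiducial (X : Matrix (Fin p) (Fin n) ℝ) (M : Finset (Fin p))
    (Y : Matrix (Fin q) (Fin n) ℝ) : Measure (Matrix (Fin q) M ℝ) :=
  matrixT ((n : ℝ) - M.card - q + 1) (lsEstimator X M Y) (rss X M Y) (gram X M)⁻¹

/-- The fiducial expectation `E(h_ε(B_M))`, a function of the data `Y`. -/
noncomputable def expectH (ε : ℝ) (X : Matrix (Fin p) (Fin n) ℝ) (M : Finset (Fin p))
    (Y : Matrix (Fin q) (Fin n) ℝ) : ℝ :=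
  ∫ BM, hFun ε X M Y BM ∂(fiducial X M Y)

/-- The `ε`-admissibility condition on the true model `M` with coefficient matrix `B0` and error
covariance `V0`: `|M| < n ^ α`, and `ε` is smaller than the scaled squared distance between the true
mean and its best approximation by a model with fewer predictors. -/
def AdmissibilityCondition (α ε : ℝ) (X : Matrix (Fin p) (Fin n) ℝ) (M : Finset (Fin p))
    (B0 : Matrix (Fin q) M ℝ) (V0 : Matrix (Fin q) (Fin q) ℝ) : Prop :=
  (M.card : ℝ) < (n : ℝ) ^ α ∧
    ∃ Bmin : Matrix (Fin q) (Fin p) ℝ,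
      IsSparseMin V0 (B0 * rowsOf X M) X M.card Bmin ∧
      ε < 1 / (36 * q * ((n : ℝ) - M.card)) * objective V0 (B0 * rowsOf X M) X Bmin

end Regression

/-- `V_{3,n}`, for a true model of size `k` and a covariance matrix with extreme eigenvalues `lmin`
and `lmax`. -/
noncomputable def V3 (q n k : ℕ) (ε lmin lmax : ℝ) : ℝ :=
  Real.exp (-(ε * ((n : ℝ) - k) * lmin) / (4 * lmax) + q * k / 2)
    + Real.exp (-0.04 * ((n : ℝ) - k)) + Real.exp (-0.15 * q * ((n : ℝ) - k))

end EAS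

/-!
Write the data as `Y = B⁰ X_M + V^{1/2} Z` with `Z` a standard Gaussian matrix, let `H` be the hat
matrix, `k = |M|`, `N = n - k` and `U = Z (1 - H)`, so that `Σ̂ = V^{1/2} U Uᵀ V^{1/2}`. The
`Σ̂⁻¹`-weighted distance of `B_M X_M` from any sparse fit `B X` is, by the triangle inequality, at
least that of the signal `B⁰ X_M` from `B X`, less those of the least squares fit from the signal
and of `B_M X_M` from the least squares fit. These are controlled as follows.

* `‖U‖² ≤ 2 q N`, so that `Σ̂ ≤ 2 q N V` and the hypothesis on `ε` makes the first distance at least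
  `√(18 ε) = 3 √(2 ε)`. The bound fails with probability at most `exp (-0.15 q N)`, by a Chernoff
  bound.
* `U Uᵀ ≥ N / 2` and `‖Z H‖² ≤ ε N`, which make the second distance at most `√(2 ε)`. The former
  fails with probability at most `exp (-0.04 N)` for large `N`: this is a Chernoff bound at each
  point of a finite net of the unit sphere of `ℝ^q`, a net that depends on `q` only
  (`half_mul_frobSq_le_of_net`). The latter is again a Chernoff bound.
* The third distance exceeds `√(2 ε)` with small fiducial probability, which is read off the density
  of the standardised matrix `t`-distribution without a representation by Wishart matrices
  (`matrixT_tail_le`). Since `1 + ‖T‖² ≤ det (1 + T Tᵀ) ≤ exp ‖T‖²`, the normalising integral is at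
  least a Gaussian one. The part of the tail where `‖T‖² ≤ 1` is also comparable with a Gaussian
  integral, and the part where `‖T‖² > 1` carries a factor `2 ^ (-n / 2)`, which beats the
  normalisation `n ^ (q k / 2)` because `k < n ^ α`.

So every `B_M` within `√(2 ε)` of the least squares fit is `ε`-admissible on an event of probability
at least `1 - V_{3,n}` (`one_sub_tTailBound_le_expectH`). All Gaussian estimates are about
`⟨v, T v⟩` with `T` symmetric and idempotent, a chi-squared variable with `tr T` degrees of freedom
(`mgf_quadForm`).
-/

namespace EAS

/-! ### Gaussian quadratic forms -/

section GaussianForms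

variable {ι : Type*} [Fintype ι] [DecidableEq ι]

/-- Squares of standard normal variables have exponential moments of every order below `1 / 2`. -/
lemma integrable_exp_mul_sq_gaussianReal {θ : ℝ} (hθ : θ < 1 / 2) :
    Integrable (fun x : ℝ => Real.exp (θ * x ^ 2)) (gaussianReal 0 1) := by
  rw [gaussianReal_of_var_ne_zero _ one_ne_zero,
    integrable_withDensity_iff_integrable_smul' (measurable_gaussianPDF 0 1)
      (ae_of_all _ fun _ => gaussianPDF_lt_top)]
  have h := (integrable_exp_neg_mul_sq (b := 1 / 2 - θ) (by linarith)).const_mul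
    (Real.sqrt (2 * Real.pi * (1 : NNReal)))⁻¹
  refine h.congr (ae_of_all _ fun x => ?_)
  simp only [toReal_gaussianPDF, gaussianPDFReal, smul_eq_mul, mul_assoc, ← Real.exp_add]
  congr 2
  simp
  ring

lemma integral_exp_mul_sq_gaussianReal {θ : ℝ} (hθ : θ < 1 / 2) :
    ∫ x, Real.exp (θ * x ^ 2) ∂(gaussianReal 0 1) = (1 - 2 * θ) ^ (-(1 / 2) : ℝ) := by
  rw [integral_gaussianReal_eq_integral_smul one_ne_zero]
  have h : ∀ x : ℝ, gaussianPDFReal 0 1 x • Real.exp (θ * x ^ 2) =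
      (Real.sqrt (2 * Real.pi))⁻¹ * Real.exp (-(1 / 2 - θ) * x ^ 2) := fun x => by
    simp only [gaussianPDFReal, smul_eq_mul, mul_assoc, ← Real.exp_add]
    congr 2
    · simp
    · simp
      ring
  simp_rw [h]
  have h0 : 0 < 1 - 2 * θ := by linarith
  rw [integral_const_mul, integral_gaussian, Real.rpow_neg h0.le, ← Real.sqrt_eq_rpow,
    ← Real.sqrt_inv, ← Real.sqrt_inv, ← Real.sqrt_mul (by positivity)]
  congr 1
  have : (1 / 2 - θ) ≠ 0 := by linarith
  have := Real.pi_ne_zero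
  field_simp

/-- The eigenvalues of a symmetric idempotent matrix are `0` and `1`. -/
lemma eigenvalues_eq_zero_or_one {T : Matrix ι ι ℝ} (hT : T.IsHermitian) (hTT : T * T = T) (i : ι) :
    hT.eigenvalues i = 0 ∨ hT.eigenvalues i = 1 := by
  have h1 := hT.mulVec_eigenvectorBasis i
  have h2 : T *ᵥ (T *ᵥ (hT.eigenvectorBasis i).ofLp) = T *ᵥ (hT.eigenvectorBasis i).ofLp := by
    rw [mulVec_mulVec, hTT]
  rw [h1, mulVec_smul, h1, smul_smul] at h2
  have hne : (hT.eigenvectorBasis i).ofLp ≠ 0 := fun h =>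
    (hT.eigenvectorBasis.orthonormal.ne_zero i) (by ext j; simpa using congrFun h j)
  have h3 := smul_left_injective ℝ hne h2
  have h4 : hT.eigenvalues i * (hT.eigenvalues i - 1) = 0 := by
    linarith
  rcases mul_eq_zero.1 h4 with h | h
  · exact Or.inl h
  · exact Or.inr (by linarith)

/-- In the coordinates of an orthonormal eigenbasis a quadratic form is a weighted sum of
squares. -/
lemma quadForm_eigenvectorBasis {T : Matrix ι ι ℝ} (hT : T.IsHermitian) (x : ι → ℝ) :
    (∑ i, x i • hT.eigenvectorBasis i).ofLp ⬝ᵥ T *ᵥ (∑ i, x i • hT.eigenvectorBasis i).ofLp =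
      ∑ i, hT.eigenvalues i * x i ^ 2 := by
  have h1 : T *ᵥ (∑ i, x i • hT.eigenvectorBasis i).ofLp =
      (∑ i, (hT.eigenvalues i * x i) • hT.eigenvectorBasis i).ofLp := by
    simp only [WithLp.ofLp_sum, WithLp.ofLp_smul, mulVec_sum, mulVec_smul,
      hT.mulVec_eigenvectorBasis, smul_smul, mul_comm]
  have h2 : ∀ u v : EuclideanSpace ℝ ι, u.ofLp ⬝ᵥ v.ofLp = inner ℝ u v := fun u v => by
    rw [EuclideanSpace.inner_eq_star_dotProduct, star_trivial, dotProduct_comm]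
  rw [h1, h2, hT.eigenvectorBasis.orthonormal.inner_sum]
  exact Finset.sum_congr rfl fun i _ => by simp; ring

variable {T : Matrix ι ι ℝ}

lemma integrable_exp_quadForm (hT : T.IsHermitian) (hTT : T * T = T) {θ : ℝ} (hθ : θ < 1 / 2) :
    Integrable (fun x => Real.exp (θ * (x.ofLp ⬝ᵥ T *ᵥ x.ofLp)))
      (stdGaussian (EuclideanSpace ℝ ι)) := by
  rw [stdGaussian_eq_map_pi_orthonormalBasis hT.eigenvectorBasis,
    integrable_map_measure (Measurable.aestronglyMeasurable (by
      simp only [dotProduct, mulVec]; fun_prop)) (Measurable.aemeasurable (by fun_prop))]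
  simp only [Function.comp_def, quadForm_eigenvectorBasis hT, Finset.mul_sum, Real.exp_sum]
  refine Integrable.fintype_prod (f := fun i (t : ℝ) =>
    Real.exp (θ * (hT.eigenvalues i * t ^ 2))) fun i => ?_
  rcases eigenvalues_eq_zero_or_one hT hTT i with h | h
  · simp [h]
  · simpa [h] using integrable_exp_mul_sq_gaussianReal hθ

/-- A Gaussian quadratic form with a symmetric idempotent matrix has the moment generating function
of a chi-squared variable with `tr T` degrees of freedom. -/
lemma mgf_quadForm (hT : T.IsHermitian) (hTT : T * T = T) {θ : ℝ} (hθ : θ < 1 / 2) :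
    mgf (fun x => x.ofLp ⬝ᵥ T *ᵥ x.ofLp) (stdGaussian (EuclideanSpace ℝ ι)) θ =
      (1 - 2 * θ) ^ (-(T.trace / 2)) := by
  have h0 : 0 < 1 - 2 * θ := by linarith
  rw [mgf, stdGaussian_eq_map_pi_orthonormalBasis hT.eigenvectorBasis,
    integral_map (Measurable.aemeasurable (by fun_prop)) (Measurable.aestronglyMeasurable (by
      simp only [dotProduct, mulVec]; fun_prop))]
  simp only [quadForm_eigenvectorBasis hT, Finset.mul_sum, Real.exp_sum]
  rw [integral_fintype_prod_eq_prod (f := fun i (t : ℝ) =>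
    Real.exp (θ * (hT.eigenvalues i * t ^ 2)))]
  have h1 : ∀ i, ∫ t, Real.exp (θ * (hT.eigenvalues i * t ^ 2)) ∂(gaussianReal 0 1) =
      (1 - 2 * θ) ^ (-(hT.eigenvalues i / 2)) := fun i => by
    rcases eigenvalues_eq_zero_or_one hT hTT i with h | h
    · simp [h]
    · simpa [h] using integral_exp_mul_sq_gaussianReal hθ
  simp_rw [h1]
  rw [← Real.rpow_sum_of_pos h0, hT.trace_eq_sum_eigenvalues, Finset.sum_neg_distrib,
    Finset.sum_div]
  rfl

/-- Chernoff bound at `θ = 1 / 4` for the upper tail of a chi-squared variable. -/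
lemma measureReal_le_quadForm (hT : T.IsHermitian) (hTT : T * T = T) (s : ℝ) :
    (stdGaussian (EuclideanSpace ℝ ι)).real {x | s ≤ x.ofLp ⬝ᵥ T *ᵥ x.ofLp} ≤
      Real.exp (-s / 4 + Real.log 2 / 2 * T.trace) := by
  refine (measure_ge_le_exp_mul_mgf s (t := 1 / 4) (by norm_num)
    (integrable_exp_quadForm hT hTT (by norm_num))).trans (le_of_eq ?_)
  rw [mgf_quadForm hT hTT (by norm_num), Real.exp_add,
    Real.rpow_def_of_pos (by norm_num : (0 : ℝ) < 1 - 2 * (1 / 4))]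
  congr 2
  · ring
  · rw [show (1 - 2 * (1 / 4) : ℝ) = 2⁻¹ by norm_num, Real.log_inv]
    ring

/-- Chernoff bound at `θ = -1 / 3` for the lower tail of a chi-squared variable. -/
lemma measureReal_quadForm_le (hT : T.IsHermitian) (hTT : T * T = T) (htr : 0 ≤ T.trace) :
    (stdGaussian (EuclideanSpace ℝ ι)).real {x | x.ofLp ⬝ᵥ T *ᵥ x.ofLp ≤ 0.6 * T.trace} ≤
      Real.exp (-0.05 * T.trace) := by
  refine (measure_le_le_exp_mul_mgf _ (t := -(1 / 3)) (by norm_num)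
    (integrable_exp_quadForm hT hTT (by norm_num))).trans ?_
  rw [mgf_quadForm hT hTT (by norm_num),
    Real.rpow_def_of_pos (by norm_num : (0 : ℝ) < 1 - 2 * -(1 / 3)), ← Real.exp_add]
  refine Real.exp_le_exp.2 ?_
  have hlog : (1 / 2 : ℝ) ≤ Real.log (1 - 2 * -(1 / 3)) := by
    rw [Real.le_log_iff_exp_le (by norm_num)]
    have h1 := Real.exp_one_lt_d9
    have h2 : Real.exp (1 / 2) * Real.exp (1 / 2) = Real.exp 1 := by
      rw [← Real.exp_add]; norm_num
    nlinarith [Real.exp_pos (1 / 2)]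
  nlinarith

end GaussianForms

/-! ### The Frobenius norm and weighted least squares -/

section Frobenius

variable {l r m : Type*} [Fintype l] [Fintype r] [Fintype m]

lemma frobSq_nonneg (A : Matrix r m ℝ) : 0 ≤ frobSq A :=
  Finset.sum_nonneg fun _ _ => Finset.sum_nonneg fun _ _ => sq_nonneg _

lemma frobSq_transpose (A : Matrix r m ℝ) : frobSq Aᵀ = frobSq A := Finset.sum_comm

lemma frobSq_neg (A : Matrix r m ℝ) : frobSq (-A) = frobSq A := by simp [frobSq]

lemma frobSq_smul (c : ℝ) (A : Matrix r m ℝ) : frobSq (c • A) = c ^ 2 * frobSq A := by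
  simp [frobSq, mul_pow, Finset.mul_sum]

lemma frobSq_eq_trace (A : Matrix r m ℝ) : frobSq A = (Aᵀ * A).trace := by
  rw [← frobSq_transpose]
  simp [frobSq, trace, mul_apply, sq]

lemma frobSq_eq_trace' (A : Matrix r m ℝ) : frobSq A = (A * Aᵀ).trace := by
  rw [frobSq_eq_trace, trace_mul_comm]

lemma frobSq_pos {A : Matrix r m ℝ} (hA : A ≠ 0) : 0 < frobSq A := by
  refine lt_of_le_of_ne (frobSq_nonneg A) fun h => hA ?_
  rw [frobSq_eq_trace, ← conjTranspose_eq_transpose_of_trivial] at h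
  exact trace_conjTranspose_mul_self_eq_zero_iff.1 h.symm

lemma trace_mul_sq_le (A B : Matrix r m ℝ) : (Aᵀ * B).trace ^ 2 ≤ frobSq A * frobSq B := by
  have h : (Aᵀ * B).trace = ∑ p : r × m, A p.1 p.2 * B p.1 p.2 := by
    rw [Fintype.sum_prod_type_right]
    simp [trace, mul_apply]
  rw [h, frobSq, frobSq, ← Fintype.sum_prod_type', ← Fintype.sum_prod_type']
  exact Finset.sum_mul_sq_le_sq_mul_sq _ _ _

section

attribute [local instance] Matrix.frobeniusNormedAddCommGroup

lemma sqrt_frobSq_eq_norm (A : Matrix r m ℝ) : √(frobSq A) = ‖A‖ := by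
  rw [frobenius_norm_def, Real.sqrt_eq_rpow]
  simp [frobSq]

lemma sqrt_frobSq_add_le (A B : Matrix r m ℝ) :
    √(frobSq (A + B)) ≤ √(frobSq A) + √(frobSq B) := by
  simp only [sqrt_frobSq_eq_norm]
  exact norm_add_le A B

lemma frobSq_mul_le (A : Matrix l r ℝ) (B : Matrix r m ℝ) :
    frobSq (A * B) ≤ frobSq A * frobSq B := by
  rw [← Real.sqrt_le_sqrt_iff (mul_nonneg (frobSq_nonneg A) (frobSq_nonneg B)),
    Real.sqrt_mul (frobSq_nonneg A)]
  simp only [sqrt_frobSq_eq_norm]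
  exact frobenius_norm_mul A B

end

end Frobenius

section SquareRoot

variable {r m : Type*} [Fintype r] [Fintype m] [DecidableEq r] {S : Matrix r r ℝ}

lemma transpose_sqrt (S : Matrix r r ℝ) : (CFC.sqrt S)ᵀ = CFC.sqrt S := by
  have h := (nonneg_iff_posSemidef.1 (CFC.sqrt_nonneg S)).isHermitian
  rwa [IsHermitian, conjTranspose_eq_transpose_of_trivial] at h

lemma transpose_invSqrt (S : Matrix r r ℝ) : (invSqrt S)ᵀ = invSqrt S := by
  rw [invSqrt, transpose_nonsing_inv, transpose_sqrt]

lemma sqrt_mul_sqrt (hS : S.PosDef) : CFC.sqrt S * CFC.sqrt S = S :=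
  CFC.sqrt_mul_sqrt_self S hS.posSemidef.nonneg

lemma isUnit_det_sqrt (hS : S.PosDef) : IsUnit (CFC.sqrt S).det := by
  have h : IsUnit S.det := (isUnit_iff_isUnit_det S).1 hS.isUnit
  rw [← sqrt_mul_sqrt hS, det_mul] at h
  exact isUnit_of_mul_isUnit_left h

lemma invSqrt_mul_invSqrt (hS : S.PosDef) : invSqrt S * invSqrt S = S⁻¹ := by
  rw [invSqrt, ← Matrix.mul_inv_rev, sqrt_mul_sqrt hS]

lemma sqrt_mul_invSqrt (hS : S.PosDef) : CFC.sqrt S * invSqrt S = 1 :=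
  mul_nonsing_inv _ (isUnit_det_sqrt hS)

lemma frobSq_invSqrt_mul (hS : S.PosDef) (A : Matrix r m ℝ) :
    frobSq (invSqrt S * A) = (Aᵀ * S⁻¹ * A).trace := by
  rw [frobSq_eq_trace, transpose_mul, transpose_invSqrt, ← invSqrt_mul_invSqrt hS]
  simp only [Matrix.mul_assoc]

end SquareRoot

section Comparison

variable {r m m' : Type*} [Fintype r] [Fintype m] [Fintype m']
  {U : Matrix r m ℝ}

lemma posDef_mul_transpose {c : ℝ} (hc : 0 < c)
    (hU : ∀ D : Matrix r Unit ℝ, c * frobSq D ≤ frobSq (Uᵀ * D)) : (U * Uᵀ).PosDef := by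
  rw [← conjTranspose_eq_transpose_of_trivial]
  refine PosDef.mul_conjTranspose_self U ((injective_iff_map_eq_zero
    (Matrix.vecMulLinear U).toAddMonoidHom).2 fun x hx => ?_)
  have hx' : x ᵥ* U = 0 := hx
  by_contra hne
  have h1 : replicateCol Unit x ≠ 0 := fun h => hne (by
    ext i
    simpa using congrFun (congrFun h i) ())
  have h2 : Uᵀ * replicateCol Unit x = 0 := by
    rw [← mulVec_transpose] at hx'
    ext i j
    simpa [mul_apply, mulVec, dotProduct] using congrFun hx' i
  have h3 := hU (replicateCol Unit x)
  rw [h2] at h3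
  have h4 := mul_pos hc (frobSq_pos h1)
  simp [frobSq] at h3 h4
  linarith

/-- A lower bound for the quadratic form of `U Uᵀ` on vectors extends columnwise to matrices. -/
lemma frobSq_le_of_columns {c : ℝ}
    (hU : ∀ D : Matrix r Unit ℝ, c * frobSq D ≤ frobSq (Uᵀ * D)) (D : Matrix r m' ℝ) :
    c * frobSq D ≤ frobSq (Uᵀ * D) := by
  rw [← frobSq_transpose D, ← frobSq_transpose (Uᵀ * D), frobSq, frobSq, Finset.mul_sum]
  refine Finset.sum_le_sum fun j _ => ?_
  have h := hU (D.submatrix id fun _ => j)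
  simpa [frobSq, mul_apply] using h

variable [DecidableEq r] {V : Matrix r r ℝ}

lemma posDef_sqrt_mul_mul_sqrt (hV : V.PosDef) (hW : (U * Uᵀ).PosDef) :
    (CFC.sqrt V * (U * Uᵀ) * CFC.sqrt V).PosDef := by
  have h := hW.conjTranspose_mul_mul_same (B := CFC.sqrt V)
    (mulVec_injective_iff_isUnit.2 ((isUnit_iff_isUnit_det _).2 (isUnit_det_sqrt hV)))
  rwa [conjTranspose_eq_transpose_of_trivial, transpose_sqrt] at h

/-- With `S = V^{1/2} U Uᵀ V^{1/2}`, the `S⁻¹`-weighted norm of `V^{1/2} C` is the norm of `Uᵀ D`,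
where `D = (U Uᵀ)⁻¹ C`. -/
lemma frobSq_invSqrt_sandwich (hV : V.PosDef) (hW : (U * Uᵀ).PosDef) (C : Matrix r m' ℝ) :
    frobSq (invSqrt (CFC.sqrt V * (U * Uᵀ) * CFC.sqrt V) * (CFC.sqrt V * C)) =
      frobSq (Uᵀ * ((U * Uᵀ)⁻¹ * C)) := by
  rw [frobSq_invSqrt_mul (posDef_sqrt_mul_mul_sqrt hV hW), frobSq_eq_trace,
    Matrix.mul_inv_rev, Matrix.mul_inv_rev]
  have hu := (isUnit_iff_isUnit_det _).1 hW.isUnit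
  simp only [transpose_mul, transpose_nonsing_inv, transpose_transpose, transpose_sqrt]
  have h1 : Cᵀ * CFC.sqrt V * ((CFC.sqrt V)⁻¹ * ((U * Uᵀ)⁻¹ * (CFC.sqrt V)⁻¹)) *
      (CFC.sqrt V * C) = Cᵀ * (CFC.sqrt V * (CFC.sqrt V)⁻¹) * (U * Uᵀ)⁻¹ *
        ((CFC.sqrt V)⁻¹ * CFC.sqrt V) * C := by simp only [Matrix.mul_assoc]
  have h2 : Cᵀ * (U * Uᵀ)⁻¹ * U * (Uᵀ * ((U * Uᵀ)⁻¹ * C)) =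
      Cᵀ * ((U * Uᵀ)⁻¹ * (U * Uᵀ)) * (U * Uᵀ)⁻¹ * C := by simp only [Matrix.mul_assoc]
  rw [h1, h2, mul_nonsing_inv _ (isUnit_det_sqrt hV), nonsing_inv_mul _ (isUnit_det_sqrt hV),
    nonsing_inv_mul _ hu]
  simp only [Matrix.mul_one]

/-- `S ≤ ‖U‖² V` in the Loewner order, for `S = V^{1/2} U Uᵀ V^{1/2}`, in terms of the weighted
norms. -/
lemma frobSq_invSqrt_le (hV : V.PosDef) (hW : (U * Uᵀ).PosDef) (A : Matrix r m' ℝ) :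
    frobSq (invSqrt V * A) ≤
      frobSq U * frobSq (invSqrt (CFC.sqrt V * (U * Uᵀ) * CFC.sqrt V) * A) := by
  have hA : A = CFC.sqrt V * (invSqrt V * A) := by
    rw [← Matrix.mul_assoc, sqrt_mul_invSqrt hV, Matrix.one_mul]
  conv_rhs => rw [hA]
  rw [frobSq_invSqrt_sandwich hV hW]
  refine le_trans (le_of_eq ?_) (frobSq_mul_le _ _)
  rw [← Matrix.mul_assoc, ← Matrix.mul_assoc, mul_nonsing_inv _
    ((isUnit_iff_isUnit_det _).1 hW.isUnit), Matrix.one_mul]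

/-- If `c ≤ U Uᵀ` then `c V ≤ S` for `S = V^{1/2} U Uᵀ V^{1/2}`, in terms of the weighted norms. -/
lemma mul_frobSq_invSqrt_le (hV : V.PosDef) {c : ℝ} (hc : 0 < c)
    (hU : ∀ D : Matrix r Unit ℝ, c * frobSq D ≤ frobSq (Uᵀ * D)) (C : Matrix r m' ℝ) :
    c * frobSq (invSqrt (CFC.sqrt V * (U * Uᵀ) * CFC.sqrt V) * (CFC.sqrt V * C)) ≤ frobSq C := by
  have hW := posDef_mul_transpose hc hU
  have hu := (isUnit_iff_isUnit_det _).1 hW.isUnit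
  rw [frobSq_invSqrt_sandwich hV hW]
  set D := (U * Uᵀ)⁻¹ * C with hD
  have h1 := frobSq_le_of_columns hU D
  have h2 : frobSq (Uᵀ * D) = (Dᵀ * C).trace := by
    have : C = U * Uᵀ * D := by
      rw [hD, ← Matrix.mul_assoc, mul_nonsing_inv _ hu, Matrix.one_mul]
    rw [frobSq_eq_trace]
    conv_rhs => rw [this]
    simp only [transpose_mul, transpose_transpose, Matrix.mul_assoc]
  have h3 := trace_mul_sq_le D C
  rw [← h2] at h3
  have h4 := frobSq_nonneg (Uᵀ * D)
  have h5 := frobSq_nonneg C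
  rcases h4.eq_or_lt with h | h
  · rw [← h]; simpa using h5
  · -- `c ‖Uᵀ D‖⁴ ≤ c ‖D‖² ‖C‖² ≤ ‖Uᵀ D‖² ‖C‖²`
    refine le_of_mul_le_mul_right ?_ h
    nlinarith [mul_le_mul_of_nonneg_right h1 h5]

end Comparison

section Determinant

variable {r : Type*} [Fintype r] [DecidableEq r]

/-- `tr A` and `det (1 + A)` in terms of the eigenvalues of `A`. -/
lemma exists_trace_and_det_one_add_eq {A : Matrix r r ℝ} (hA : A.PosSemidef) :
    ∃ a : r → ℝ, (∀ i, 0 ≤ a i) ∧ A.trace = ∑ i, a i ∧ (1 + A).det = ∏ i, (1 + a i) := by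
  refine ⟨hA.isHermitian.eigenvalues, hA.eigenvalues_nonneg, ?_, ?_⟩
  · simpa using hA.isHermitian.trace_eq_sum_eigenvalues
  · have h1 := congrArg (Polynomial.eval (-1)) hA.isHermitian.charpoly_eq
    rw [eval_charpoly, Polynomial.eval_prod] at h1
    have h2 : (scalar r (-1 : ℝ) - A) = -(1 + A) := by
      ext i j
      by_cases h : i = j
      · simp [scalar_apply, h]; ring
      · simp [scalar_apply, h]
    rw [h2, det_neg] at h1
    have h3 : ∏ i, Polynomial.eval (-1) (Polynomial.X - Polynomial.C
        (hA.isHermitian.eigenvalues i)) =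
        (-1) ^ Fintype.card r * ∏ i, (1 + hA.isHermitian.eigenvalues i) := by
      rw [← Finset.card_univ, ← Finset.prod_const, ← Finset.prod_mul_distrib]
      exact Finset.prod_congr rfl fun i _ => by simp; ring
    have h4 : (-1 : ℝ) ^ Fintype.card r ≠ 0 := pow_ne_zero _ (by norm_num)
    exact mul_left_cancel₀ h4 (h1.trans h3)

lemma one_add_sum_le_prod {ι : Type*} (s : Finset ι) {a : ι → ℝ} (ha : ∀ i, 0 ≤ a i) :
    1 + ∑ i ∈ s, a i ≤ ∏ i ∈ s, (1 + a i) := by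
  classical
  induction s using Finset.induction_on with
  | empty => simp
  | insert i s his ih =>
    rw [Finset.sum_insert his, Finset.prod_insert his]
    have h1 := Finset.sum_nonneg fun j (_ : j ∈ s) => ha j
    nlinarith [ha i, mul_nonneg (ha i) h1]

lemma one_add_trace_le_det {A : Matrix r r ℝ} (hA : A.PosSemidef) :
    1 + A.trace ≤ (1 + A).det := by
  obtain ⟨a, ha, h1, h2⟩ := exists_trace_and_det_one_add_eq hA
  rw [h1, h2]
  exact one_add_sum_le_prod _ ha

lemma det_one_add_le_exp_trace {A : Matrix r r ℝ} (hA : A.PosSemidef) :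
    (1 + A).det ≤ Real.exp A.trace := by
  obtain ⟨a, ha, h1, h2⟩ := exists_trace_and_det_one_add_eq hA
  rw [h1, h2, Real.exp_sum]
  refine Finset.prod_le_prod (fun i _ => by linarith [ha i]) fun i _ => ?_
  linarith [Real.add_one_le_exp (a i)]

end Determinant

/-! ### Tails of the matrix `t`-distribution -/

section LebesgueMatrix

variable {r m : Type*} [Fintype r] [Fintype m]

instance : BorelSpace (Matrix r m ℝ) := inferInstanceAs (BorelSpace (r → m → ℝ))

instance : SecondCountableTopology (Matrix r m ℝ) :=
  inferInstanceAs (SecondCountableTopology (r → m → ℝ))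

instance : LocallyCompactSpace (Matrix r m ℝ) :=
  inferInstanceAs (LocallyCompactSpace (r → m → ℝ))

lemma isAddHaarMeasure_volume_pi_pi : (volume : Measure (r → m → ℝ)).IsAddHaarMeasure :=
  Measure.pi.isAddHaarMeasure _

instance : (volume : Measure (Matrix r m ℝ)).IsAddHaarMeasure := isAddHaarMeasure_volume_pi_pi

lemma integrable_prod_entries {g : ℝ → ℝ} (hg : Integrable g) :
    Integrable fun T : Matrix r m ℝ => ∏ i, ∏ j, g (T i j) :=
  Integrable.fintype_prod (f := fun (_ : r) (x : m → ℝ) => ∏ j, g (x j)) fun _ =>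
    Integrable.fintype_prod (f := fun (_ : m) (x : ℝ) => g x) fun _ => hg

lemma integral_prod_entries (g : ℝ → ℝ) :
    ∫ T : Matrix r m ℝ, ∏ i, ∏ j, g (T i j) = (∫ x, g x) ^ (Fintype.card r * Fintype.card m) := by
  have h := integral_fintype_prod_volume_eq_pow (ι := r) fun x : m → ℝ => ∏ j, g (x j)
  rw [integral_fintype_prod_volume_eq_pow (ι := m) g, ← pow_mul, mul_comm] at h
  exact h

lemma exp_frobSq (b : ℝ) (T : Matrix r m ℝ) :
    Real.exp (-b * frobSq T) = ∏ i, ∏ j, Real.exp (-b * T i j ^ 2) := by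
  simp only [frobSq, Finset.mul_sum, Real.exp_sum]

lemma integrable_exp_frobSq {b : ℝ} (hb : 0 < b) :
    Integrable fun T : Matrix r m ℝ => Real.exp (-b * frobSq T) := by
  simp only [exp_frobSq]
  exact integrable_prod_entries (g := fun x => Real.exp (-b * x ^ 2)) (integrable_exp_neg_mul_sq hb)

lemma integral_exp_frobSq (b : ℝ) :
    ∫ T : Matrix r m ℝ, Real.exp (-b * frobSq T) =
      √(Real.pi / b) ^ (Fintype.card r * Fintype.card m) := by
  simp only [exp_frobSq]
  rw [integral_prod_entries fun x => Real.exp (-b * x ^ 2), integral_gaussian]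

lemma continuous_frobSq : Continuous (frobSq : Matrix r m ℝ → ℝ) := by
  unfold frobSq
  fun_prop

/-- `(1 + ‖T‖²) ^ (-d)` is dominated by a product of Cauchy densities, one for each of the `d`
entries of `T`. -/
lemma rpow_neg_card_le_prod_cauchy (T : Matrix r m ℝ) :
    (1 + frobSq T) ^ (-((Fintype.card r * Fintype.card m : ℕ) : ℝ)) ≤
      ∏ i, ∏ j, (1 + T i j ^ 2)⁻¹ := by
  have h0 := frobSq_nonneg T
  rw [Real.rpow_neg (by linarith), Real.rpow_natCast]
  simp only [Finset.prod_inv_distrib]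
  have hpos : 0 < ∏ i, ∏ j, (1 + T i j ^ 2) :=
    Finset.prod_pos fun i _ => Finset.prod_pos fun j _ => by positivity
  refine inv_anti₀ hpos ?_
  calc ∏ i, ∏ j, (1 + T i j ^ 2) ≤ ∏ _i : r, ∏ _j : m, (1 + frobSq T) := by
        refine Finset.prod_le_prod (fun i _ => Finset.prod_nonneg fun j _ => by positivity)
          fun i _ => Finset.prod_le_prod (fun j _ => by positivity) fun j _ => ?_
        have h1 : ∑ j, T i j ^ 2 ≤ frobSq T :=
          Finset.single_le_sum (f := fun i => ∑ j, T i j ^ 2)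
            (fun i _ => Finset.sum_nonneg fun j _ => sq_nonneg _) (Finset.mem_univ i)
        have h2 : T i j ^ 2 ≤ ∑ j, T i j ^ 2 :=
          Finset.single_le_sum (f := fun j => T i j ^ 2) (fun j _ => sq_nonneg _)
            (Finset.mem_univ j)
        linarith
    _ = (1 + frobSq T) ^ (Fintype.card r * Fintype.card m) := by
        simp [Finset.prod_const, ← pow_mul, mul_comm]

/-- Linear changes of variables multiply Lebesgue integrals over matrices by a constant. -/
lemma exists_integral_affine [DecidableEq r] [DecidableEq m] {s : Matrix r r ℝ} {g : Matrix m m ℝ}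
    (hs : IsUnit s.det) (hg : IsUnit g.det) (A : Matrix r m ℝ) :
    ∃ c : ℝ, 0 < c ∧
      (∀ F : Matrix r m ℝ → ℝ, ∫ T, F (s * (T - A) * g) = c * ∫ T, F T) ∧
      ∀ F : Matrix r m ℝ → ℝ, Integrable F → Integrable fun T => F (s * (T - A) * g) := by
  let e : Matrix r m ℝ ≃+ Matrix r m ℝ :=
    { toFun := fun T => s * T * g
      invFun := fun T => s⁻¹ * T * g⁻¹
      left_inv := fun T => by
        change s⁻¹ * (s * T * g) * g⁻¹ = T
        rw [show s⁻¹ * (s * T * g) * g⁻¹ = (s⁻¹ * s) * T * (g * g⁻¹) by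
          simp only [Matrix.mul_assoc], nonsing_inv_mul _ hs, mul_nonsing_inv _ hg,
          Matrix.one_mul, Matrix.mul_one]
      right_inv := fun T => by
        change s * (s⁻¹ * T * g⁻¹) * g = T
        rw [show s * (s⁻¹ * T * g⁻¹) * g = (s * s⁻¹) * T * (g⁻¹ * g) by
          simp only [Matrix.mul_assoc], mul_nonsing_inv _ hs, nonsing_inv_mul _ hg,
          Matrix.one_mul, Matrix.mul_one]
      map_add' := fun T T' => by rw [Matrix.mul_add, Matrix.add_mul] }
  have hc : Continuous e := by
    change Continuous fun T : Matrix r m ℝ => s * T * g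
    fun_prop
  have hcs : Continuous e.symm := by
    change Continuous fun T : Matrix r m ℝ => s⁻¹ * T * g⁻¹
    fun_prop
  let h : Matrix r m ℝ ≃ₜ Matrix r m ℝ := ⟨e.toEquiv, hc, hcs⟩
  have hhaar : (Measure.map e (volume : Measure (Matrix r m ℝ))).IsAddHaarMeasure :=
    e.isAddHaarMeasure_map _ hc hcs
  have hmap := Measure.isAddLeftInvariant_eq_smul
    (Measure.map e (volume : Measure (Matrix r m ℝ))) volume
  set c := Measure.addHaarScalarFactor (Measure.map e (volume : Measure (Matrix r m ℝ))) volume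
  have hc0 : 0 < c := Measure.addHaarScalarFactor_pos_of_isAddHaarMeasure _ _
  refine ⟨c, NNReal.coe_pos.2 hc0, fun F => ?_, fun F hF => ?_⟩
  · rw [integral_sub_right_eq_self (fun T => F (s * T * g)) A]
    have h1 := integral_map_equiv (μ := (volume : Measure (Matrix r m ℝ))) h.toMeasurableEquiv F
    change ∫ y, F y ∂(Measure.map e volume) = ∫ T : Matrix r m ℝ, F (s * T * g) at h1
    rw [← h1, hmap, integral_smul_nnreal_measure]
    rfl
  · have h1 : Integrable F (Measure.map e volume) := by
      rw [hmap]
      exact hF.smul_measure_nnreal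
    have h2 := (h.measurableEmbedding.integrable_map_iff (μ := volume) (g := F)).1 h1
    exact Integrable.comp_sub_right (f := fun T : Matrix r m ℝ => F (s * T * g)) h2 A

end LebesgueMatrix

section StandardTail

variable {r m : Type*} [Fintype r] [Fintype m]

lemma exp_le_one_add_two_mul {y : ℝ} (h0 : 0 ≤ y) (h1 : y ≤ 1 / 2) :
    Real.exp y ≤ 1 + 2 * y := by
  have h := Real.exp_bound_div_one_sub_of_interval h0 (by linarith)
  refine h.trans ?_
  rw [div_le_iff₀ (by linarith)]
  nlinarith

/-- The bound of the tail `‖T‖² > 2 ε` of a density between `exp (-n ‖T‖² / 2)` and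
`(1 + ‖T‖²) ^ (-n / 2)`; here `d` is the dimension. The first summand comes from the region
`‖T‖² ≤ 1`, the second from `‖T‖² > 1`. -/
noncomputable def tTailBound (n ε : ℝ) (d : ℕ) : ℝ :=
  Real.exp (-(n * ε / 10) + d / 2) + 2 ^ ((d : ℝ) - n / 2) * √(Real.pi * n / 2) ^ d

/-- Where `1 + x ≥ exp (x / 2)`, that is for `x ≤ 1`, the upper bound is compared with a Gaussian
density, elsewhere with a product of Cauchy densities. -/
lemma le_gaussian_add_cauchy {n ε : ℝ} (hn0 : 0 < n)
    (hn : 2 * ((Fintype.card r * Fintype.card m : ℕ) : ℝ) ≤ n) (T : Matrix r m ℝ)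
    (hT : 2 * ε < frobSq T) :
    (1 + frobSq T) ^ (-(n / 2)) ≤
      Real.exp (-(n * ε / 10)) * Real.exp (-(n / 5) * frobSq T) +
        2 ^ (((Fintype.card r * Fintype.card m : ℕ) : ℝ) - n / 2) *
          ∏ i, ∏ j, (1 + T i j ^ 2)⁻¹ := by
  have h0 := frobSq_nonneg T
  have hprod : 0 ≤ ∏ i, ∏ j, (1 + T i j ^ 2)⁻¹ :=
    Finset.prod_nonneg fun i _ => Finset.prod_nonneg fun j _ => by positivity
  rcases le_or_gt (frobSq T) 1 with h1 | h1
  · refine le_add_of_le_of_nonneg ?_ (mul_nonneg (by positivity) hprod)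
    have h2 : frobSq T / 2 ≤ Real.log (1 + frobSq T) := by
      rw [Real.le_log_iff_exp_le (by linarith)]
      have := exp_le_one_add_two_mul (y := frobSq T / 2) (by linarith) (by linarith)
      linarith
    rw [Real.rpow_def_of_pos (by linarith), ← Real.exp_add]
    refine Real.exp_le_exp.2 ?_
    nlinarith [mul_le_mul_of_nonneg_right h2 hn0.le, mul_lt_mul_of_pos_right hT hn0]
  · refine le_add_of_nonneg_of_le (by positivity) ?_
    set d : ℝ := ((Fintype.card r * Fintype.card m : ℕ) : ℝ) with hd
    have h2 := rpow_neg_card_le_prod_cauchy T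
    rw [← hd] at h2
    rw [show -(n / 2) = (d - n / 2) + -d by ring, Real.rpow_add (by linarith)]
    refine mul_le_mul ?_ h2 (by positivity) (by positivity)
    exact Real.rpow_le_rpow_of_nonpos (by norm_num) (by linarith) (by linarith)

variable {n ε : ℝ} {φ : Matrix r m ℝ → ℝ}

lemma integrable_of_le_rpow (hn : 2 * ((Fintype.card r * Fintype.card m : ℕ) : ℝ) ≤ n)
    (hφm : Measurable φ) (hφ0 : ∀ T, 0 ≤ φ T)
    (hφ : ∀ T, φ T ≤ (1 + frobSq T) ^ (-(n / 2))) : Integrable φ := by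
  refine (integrable_prod_entries (r := r) (m := m) integrable_inv_one_add_sq).mono'
    hφm.aestronglyMeasurable (ae_of_all _ fun T => ?_)
  rw [Real.norm_of_nonneg (hφ0 T)]
  refine (hφ T).trans (le_trans ?_ (rpow_neg_card_le_prod_cauchy T))
  exact Real.rpow_le_rpow_of_exponent_le (by linarith [frobSq_nonneg T]) (by linarith)

lemma sqrt_pow_le_integral (hn0 : 0 < n) (hφi : Integrable φ)
    (hφ : ∀ T, Real.exp (-(n / 2) * frobSq T) ≤ φ T) :
    √(2 * Real.pi / n) ^ (Fintype.card r * Fintype.card m) ≤ ∫ T, φ T := by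
  have h := integral_mono (integrable_exp_frobSq (r := r) (m := m) (half_pos hn0)) hφi hφ
  rw [integral_exp_frobSq] at h
  rwa [show Real.pi / (n / 2) = 2 * Real.pi / n by field_simp] at h

lemma setIntegral_tail_le (hn0 : 0 < n)
    (hn : 2 * ((Fintype.card r * Fintype.card m : ℕ) : ℝ) ≤ n)
    (hφm : Measurable φ) (hφl : ∀ T, Real.exp (-(n / 2) * frobSq T) ≤ φ T)
    (hφu : ∀ T, φ T ≤ (1 + frobSq T) ^ (-(n / 2))) :
    ∫ T in {T | 2 * ε < frobSq T}, φ T ≤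
      tTailBound n ε (Fintype.card r * Fintype.card m) * ∫ T, φ T := by
  have hφ0 : ∀ T, 0 ≤ φ T := fun T => (Real.exp_pos _).le.trans (hφl T)
  have hφi := integrable_of_le_rpow hn hφm hφ0 hφu
  have hI := sqrt_pow_le_integral hn0 hφi hφl
  set d := Fintype.card r * Fintype.card m with hd
  have hms : MeasurableSet {T : Matrix r m ℝ | 2 * ε < frobSq T} :=
    measurableSet_lt measurable_const continuous_frobSq.measurable
  let ψ : Matrix r m ℝ → ℝ := fun T =>
    Real.exp (-(n * ε / 10)) * Real.exp (-(n / 5) * frobSq T) +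
      2 ^ ((d : ℝ) - n / 2) * ∏ i, ∏ j, (1 + T i j ^ 2)⁻¹
  have hψ0 : ∀ T, 0 ≤ ψ T := fun T => add_nonneg (by positivity) (mul_nonneg (by positivity)
    (Finset.prod_nonneg fun i _ => Finset.prod_nonneg fun j _ => by positivity))
  have hi1 := (integrable_exp_frobSq (r := r) (m := m)
    (show 0 < n / 5 by positivity)).const_mul (Real.exp (-(n * ε / 10)))
  have hi2 := (integrable_prod_entries (r := r) (m := m) integrable_inv_one_add_sq).const_mul
    (2 ^ ((d : ℝ) - n / 2))
  have hψi : Integrable ψ := hi1.add hi2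
  have h1 : ∫ T in {T | 2 * ε < frobSq T}, φ T ≤ ∫ T, ψ T :=
    (setIntegral_mono_on hφi.integrableOn hψi.integrableOn hms fun T hT =>
      (hφu T).trans (le_gaussian_add_cauchy hn0 hn T hT)).trans
      (setIntegral_le_integral hψi (ae_of_all _ hψ0))
  have h2 : ∫ T, ψ T = Real.exp (-(n * ε / 10)) * √(Real.pi / (n / 5)) ^ d +
      2 ^ ((d : ℝ) - n / 2) * Real.pi ^ d := by
    rw [integral_add hi1 hi2, integral_const_mul, integral_const_mul, integral_exp_frobSq,
      integral_prod_entries fun x => (1 + x ^ 2)⁻¹, integral_univ_inv_one_add_sq]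
  have hpi := Real.pi_pos
  -- `√(5 / 2) ≤ exp (1 / 2)`
  have h3 : √(Real.pi / (n / 5)) ^ d ≤ Real.exp (d / 2) * √(2 * Real.pi / n) ^ d := by
    rw [show (d : ℝ) / 2 = d * (1 / 2) by ring, Real.exp_nat_mul, ← mul_pow]
    refine pow_le_pow_left₀ (Real.sqrt_nonneg _) ?_ d
    have he : Real.exp (1 / 2) = √(Real.exp 1) := by
      rw [Real.exp_half]
    rw [he, ← Real.sqrt_mul (Real.exp_pos 1).le]
    refine Real.sqrt_le_sqrt ?_
    have h4 : Real.pi / (n / 5) = 5 / 2 * (2 * Real.pi / n) := by field_simp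
    rw [h4]
    have := Real.exp_one_gt_d9
    exact mul_le_mul_of_nonneg_right (by linarith) (by positivity)
  have h5 : Real.pi ^ d = √(Real.pi * n / 2) ^ d * √(2 * Real.pi / n) ^ d := by
    rw [← mul_pow, ← Real.sqrt_mul (by positivity)]
    congr 1
    rw [show Real.pi * n / 2 * (2 * Real.pi / n) = Real.pi ^ 2 by field_simp,
      Real.sqrt_sq hpi.le]
  calc _ ≤ ∫ T, ψ T := h1
    _ ≤ Real.exp (-(n * ε / 10)) * (Real.exp (d / 2) * √(2 * Real.pi / n) ^ d) +
        2 ^ ((d : ℝ) - n / 2) * (√(Real.pi * n / 2) ^ d * √(2 * Real.pi / n) ^ d) := by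
      rw [h2, h5]
      gcongr
    _ = tTailBound n ε d * √(2 * Real.pi / n) ^ d := by
      rw [tTailBound, Real.exp_add]
      ring
    _ ≤ tTailBound n ε d * ∫ T, φ T := by
      refine mul_le_mul_of_nonneg_left hI ?_
      unfold tTailBound
      positivity

end StandardTail

section MatrixT

variable {r m : Type*} [Fintype r] [Fintype m] [DecidableEq r] {S : Matrix r r ℝ}
  {W : Matrix m m ℝ} {n ε ν : ℝ}

/-- The standard matrix `t`-density, up to normalisation. -/
noncomputable def stdTKernel (n : ℝ) (K : Matrix r m ℝ) : ℝ := (1 + K * Kᵀ).det ^ (-(n / 2))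

lemma one_add_frobSq_le_det (K : Matrix r m ℝ) : 1 + frobSq K ≤ (1 + K * Kᵀ).det := by
  rw [frobSq_eq_trace']
  exact one_add_trace_le_det (by
    simpa only [conjTranspose_eq_transpose_of_trivial] using posSemidef_self_mul_conjTranspose K)

lemma stdTKernel_le (hn : 0 < n) (K : Matrix r m ℝ) :
    stdTKernel n K ≤ (1 + frobSq K) ^ (-(n / 2)) :=
  Real.rpow_le_rpow_of_nonpos (by linarith [frobSq_nonneg K]) (one_add_frobSq_le_det K)
    (by linarith)

lemma le_stdTKernel (hn : 0 < n) (K : Matrix r m ℝ) :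
    Real.exp (-(n / 2) * frobSq K) ≤ stdTKernel n K := by
  have h0 : 0 < (1 + K * Kᵀ).det := by linarith [frobSq_nonneg K, one_add_frobSq_le_det K]
  have h1 : (1 + K * Kᵀ).det ≤ Real.exp (frobSq K) := by
    rw [frobSq_eq_trace']
    exact det_one_add_le_exp_trace (by
      simpa only [conjTranspose_eq_transpose_of_trivial] using posSemidef_self_mul_conjTranspose K)
  rw [mul_comm, Real.exp_mul]
  exact Real.rpow_le_rpow_of_nonpos h0 h1 (by linarith)

lemma measurable_stdTKernel : Measurable (stdTKernel n : Matrix r m ℝ → ℝ) := by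
  unfold stdTKernel
  refine Measurable.pow_const (Continuous.measurable ?_) _
  exact Continuous.matrix_det (by fun_prop)

lemma isUnit_det_invSqrt (hS : S.PosDef) : IsUnit (invSqrt S).det :=
  isUnit_nonsing_inv_det _ (isUnit_det_sqrt hS)

variable [DecidableEq m]

/-- Standardising by `S^{-1/2}` and `W^{-1/2}` reduces the kernel to the standard one, by the
Weinstein–Aronszajn identity `det (1 + A B) = det (1 + B A)`. -/
lemma matrixTKernel_eq (hS : S.PosDef) (hW : W.PosDef)
    (hν : ν + Fintype.card m + Fintype.card r - 1 = n) (A T : Matrix r m ℝ) :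
    matrixTKernel ν A S W T = stdTKernel n (invSqrt S * (T - A) * invSqrt W) := by
  rw [matrixTKernel, stdTKernel, hν, ← invSqrt_mul_invSqrt hS, ← invSqrt_mul_invSqrt hW, neg_div]
  congr 1
  rw [show invSqrt S * invSqrt S * (T - A) * (invSqrt W * invSqrt W) * (T - A)ᵀ =
    invSqrt S * (invSqrt S * (T - A) * invSqrt W * (invSqrt W * (T - A)ᵀ)) by
      simp only [Matrix.mul_assoc], det_one_add_mul_comm]
  simp only [transpose_mul, transpose_invSqrt, Matrix.mul_assoc]

lemma integrable_and_integral_matrixTKernel_pos (hS : S.PosDef) (hW : W.PosDef) (hn0 : 0 < n)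
    (hν : ν + Fintype.card m + Fintype.card r - 1 = n)
    (hn : 2 * ((Fintype.card r * Fintype.card m : ℕ) : ℝ) ≤ n) (A : Matrix r m ℝ) :
    Integrable (matrixTKernel ν A S W) ∧ 0 < ∫ T, matrixTKernel ν A S W T := by
  obtain ⟨c, hc, hint, hi⟩ := exists_integral_affine (isUnit_det_invSqrt hS)
    (isUnit_det_invSqrt hW) A
  have hφi : Integrable (stdTKernel n : Matrix r m ℝ → ℝ) :=
    integrable_of_le_rpow hn measurable_stdTKernel
      (fun K => (Real.exp_pos _).le.trans (le_stdTKernel hn0 K)) (stdTKernel_le hn0)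
  have heq : matrixTKernel ν A S W = fun T => stdTKernel n (invSqrt S * (T - A) * invSqrt W) :=
    funext (matrixTKernel_eq hS hW hν A)
  rw [heq]
  refine ⟨hi _ hφi, ?_⟩
  rw [hint]
  have := sqrt_pow_le_integral hn0 hφi (le_stdTKernel hn0)
  have hpi := Real.pi_pos
  have : 0 < √(2 * Real.pi / n) ^ (Fintype.card r * Fintype.card m) := by positivity
  exact mul_pos hc (by linarith)

lemma matrixTKernel_nonneg (hS : S.PosDef) (hW : W.PosDef) (hn0 : 0 < n)
    (hν : ν + Fintype.card m + Fintype.card r - 1 = n) (A T : Matrix r m ℝ) :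
    0 ≤ matrixTKernel ν A S W T := by
  rw [matrixTKernel_eq hS hW hν]
  exact (Real.exp_pos _).le.trans (le_stdTKernel hn0 _)

lemma matrixT_apply (hS : S.PosDef) (hW : W.PosDef) (hn0 : 0 < n)
    (hν : ν + Fintype.card m + Fintype.card r - 1 = n)
    (hn : 2 * ((Fintype.card r * Fintype.card m : ℕ) : ℝ) ≤ n) (A : Matrix r m ℝ)
    {E : Set (Matrix r m ℝ)} (hE : MeasurableSet E) :
    matrixT ν A S W E = ENNReal.ofReal
      ((∫ T in E, matrixTKernel ν A S W T) / ∫ T, matrixTKernel ν A S W T) := by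
  obtain ⟨hi, hpos⟩ := integrable_and_integral_matrixTKernel_pos hS hW hn0 hν hn A
  have h0 := matrixTKernel_nonneg hS hW hn0 hν A
  rw [matrixT, Measure.smul_apply, withDensity_apply _ hE,
    ← ofReal_integral_eq_lintegral_ofReal hi (ae_of_all _ h0),
    ← ofReal_integral_eq_lintegral_ofReal hi.integrableOn (ae_of_all _ h0), smul_eq_mul,
    ← ENNReal.ofReal_inv_of_pos hpos, ← ENNReal.ofReal_mul (inv_pos.2 hpos).le, div_eq_inv_mul]

lemma isProbabilityMeasure_matrixT (hS : S.PosDef) (hW : W.PosDef) (hn0 : 0 < n)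
    (hν : ν + Fintype.card m + Fintype.card r - 1 = n)
    (hn : 2 * ((Fintype.card r * Fintype.card m : ℕ) : ℝ) ≤ n) (A : Matrix r m ℝ) :
    IsProbabilityMeasure (matrixT ν A S W) := by
  refine ⟨?_⟩
  rw [matrixT_apply hS hW hn0 hν hn A MeasurableSet.univ, setIntegral_univ, div_self
    (integrable_and_integral_matrixTKernel_pos hS hW hn0 hν hn A).2.ne', ENNReal.ofReal_one]

/-- The tail of the matrix `t`-distribution in terms of the standardised matrix. -/
theorem matrixT_tail_le (hS : S.PosDef) (hW : W.PosDef) (hn0 : 0 < n)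
    (hν : ν + Fintype.card m + Fintype.card r - 1 = n)
    (hn : 2 * ((Fintype.card r * Fintype.card m : ℕ) : ℝ) ≤ n) (A : Matrix r m ℝ) :
    (matrixT ν A S W).real {T | 2 * ε < frobSq (invSqrt S * (T - A) * invSqrt W)} ≤
      tTailBound n ε (Fintype.card r * Fintype.card m) := by
  obtain ⟨c, hc, hint, -⟩ := exists_integral_affine (isUnit_det_invSqrt hS)
    (isUnit_det_invSqrt hW) A
  have hpos := (integrable_and_integral_matrixTKernel_pos hS hW hn0 hν hn A).2
  have hstd : MeasurableSet {K : Matrix r m ℝ | 2 * ε < frobSq K} :=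
    measurableSet_lt measurable_const continuous_frobSq.measurable
  have hE : MeasurableSet {T | 2 * ε < frobSq (invSqrt S * (T - A) * invSqrt W)} :=
    measurableSet_lt measurable_const (continuous_frobSq.comp (by fun_prop)).measurable
  rw [measureReal_def, matrixT_apply hS hW hn0 hν hn A hE, ENNReal.toReal_ofReal (div_nonneg
    (integral_nonneg fun T => matrixTKernel_nonneg hS hW hn0 hν A T) hpos.le), div_le_iff₀ hpos]
  have h1 : ∫ T in {T | 2 * ε < frobSq (invSqrt S * (T - A) * invSqrt W)},
      matrixTKernel ν A S W T = c * ∫ K in {K : Matrix r m ℝ | 2 * ε < frobSq K},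
        stdTKernel n K := by
    rw [← integral_indicator hE, ← integral_indicator hstd, ← hint]
    refine integral_congr_ae (ae_of_all _ fun T => ?_)
    simp only [Set.indicator, Set.mem_ofPred_eq, matrixTKernel_eq hS hW hν]
  have h2 : ∫ T, matrixTKernel ν A S W T = c * ∫ K : Matrix r m ℝ, stdTKernel n K := by
    rw [← hint]
    exact integral_congr_ae (ae_of_all _ fun T => matrixTKernel_eq hS hW hν A T)
  rw [h1, h2]
  have h3 := setIntegral_tail_le (ε := ε) hn0 hn (measurable_stdTKernel (r := r) (m := m))
    (le_stdTKernel hn0) (stdTKernel_le hn0)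
  nlinarith

end MatrixT

/-! ### The regression design and the fiducial expectation -/

section SparseMinimiser

variable {q n p : ℕ}

attribute [local instance] Matrix.frobeniusNormedAddCommGroup Matrix.frobeniusNormedSpace

/-- The coefficient matrices with columns supported in `J`. -/
def supportedIn (q : ℕ) (J : Finset (Fin p)) : Submodule ℝ (Matrix (Fin q) (Fin p) ℝ) where
  carrier := {B | ∀ i, ∀ j ∉ J, B i j = 0}
  add_mem' hA hB i j hj := by simp [hA i j hj, hB i j hj]
  zero_mem' _ _ _ := rfl
  smul_mem' c B hB i j hj := by simp [hB i j hj]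

lemma isFeasible_iff {k : ℕ} {B : Matrix (Fin q) (Fin p) ℝ} :
    IsFeasible k B ↔ ∃ J : Finset (Fin p), J.card + 1 ≤ k ∧ B ∈ supportedIn q J := by
  classical
  constructor
  · intro h
    refine ⟨Finset.univ.filter fun j => (fun i => B i j) ≠ 0, ?_, fun i j hj => ?_⟩
    · rw [IsFeasible, Set.ncard_eq_toFinset_card'] at h
      simpa [Set.toFinset_ofPred] using h
    · have h1 : (fun i => B i j) = 0 := by simpa using hj
      exact congrFun h1 i
  · rintro ⟨J, hJ, hB⟩
    refine le_trans (Nat.add_le_add_right ?_ 1) hJ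
    rw [← Set.ncard_coe_finset J]
    refine Set.ncard_le_ncard (fun j hj => ?_) J.finite_toSet
    by_contra hj'
    exact hj (funext fun i => hB i j hj')

/-- The sparse least squares problem has a solution: the fitted values range over a finite union of
linear subspaces, a closed set. -/
lemma exists_isSparseMin (S : Matrix (Fin q) (Fin q) ℝ) (F : Matrix (Fin q) (Fin n) ℝ)
    (X : Matrix (Fin p) (Fin n) ℝ) {k : ℕ} (hk : 1 ≤ k) : ∃ B, IsSparseMin S F X k B := by
  classical
  let L : Matrix (Fin q) (Fin p) ℝ →ₗ[ℝ] Matrix (Fin q) (Fin n) ℝ :=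
    { toFun := fun B => invSqrt S * (B * X)
      map_add' := fun A B => by rw [Matrix.add_mul, Matrix.mul_add]
      map_smul' := fun c B => by simp }
  let K : Set (Matrix (Fin q) (Fin n) ℝ) :=
    ⋃ J ∈ Finset.univ.filter (fun J : Finset (Fin p) => J.card + 1 ≤ k),
      ((supportedIn q J).map L : Set (Matrix (Fin q) (Fin n) ℝ))
  have hK : ∀ T, T ∈ K ↔ ∃ B, IsFeasible k B ∧ L B = T := fun T => by
    simp only [K, Set.mem_iUnion, Finset.mem_filter, Finset.mem_univ, true_and, exists_prop,
      SetLike.mem_coe, Submodule.mem_map, isFeasible_iff]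
    constructor
    · rintro ⟨J, hJ, B, hB, h⟩
      exact ⟨B, ⟨J, hJ, hB⟩, h⟩
    · rintro ⟨B, ⟨J, hJ, hB⟩, h⟩
      exact ⟨J, hJ, B, hB, h⟩
  have hclosed : IsClosed K :=
    isClosed_biUnion_finset fun J _ => Submodule.closed_of_finiteDimensional _
  have hne : K.Nonempty := ⟨L 0, (hK _).2 ⟨0, isFeasible_iff.2 ⟨∅, by simpa using hk,
    Submodule.zero_mem _⟩, rfl⟩⟩
  have : ProperSpace (Matrix (Fin q) (Fin n) ℝ) := FiniteDimensional.proper_real _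
  obtain ⟨T, hT, hmin⟩ := hclosed.exists_infDist_eq_dist hne (invSqrt S * F)
  obtain ⟨B, hB, rfl⟩ := (hK T).1 hT
  refine ⟨B, hB, fun B' hB' => ?_⟩
  have h1 : dist (invSqrt S * F) (L B) ≤ dist (invSqrt S * F) (L B') := by
    rw [← hmin]
    exact Metric.infDist_le_dist_of_mem ((hK _).2 ⟨B', hB', rfl⟩)
  rw [dist_eq_norm, dist_eq_norm, ← sqrt_frobSq_eq_norm, ← sqrt_frobSq_eq_norm,
    Real.sqrt_le_sqrt_iff (frobSq_nonneg _)] at h1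
  simp only [objective, Matrix.mul_sub]
  exact h1

end SparseMinimiser

section Design

variable {q n p : ℕ} {X : Matrix (Fin p) (Fin n) ℝ} {M : Finset (Fin p)}

lemma isUnit_det_gram (hG : IsUnit (gram X M)) : IsUnit (gram X M).det :=
  (isUnit_iff_isUnit_det _).1 hG

lemma transpose_gram : (gram X M)ᵀ = gram X M := by
  rw [gram, transpose_mul, transpose_transpose]

lemma posDef_gram (hG : IsUnit (gram X M)) : (gram X M).PosDef := by
  have h : (gram X M).PosSemidef := by
    rw [gram, ← conjTranspose_eq_transpose_of_trivial]
    exact posSemidef_self_mul_conjTranspose _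
  exact h.posDef_iff_isUnit.2 hG

lemma transpose_hatMatrix : (hatMatrix X M)ᵀ = hatMatrix X M := by
  rw [hatMatrix, transpose_mul, transpose_mul, transpose_nonsing_inv, transpose_gram,
    transpose_transpose, Matrix.mul_assoc]

lemma rowsOf_mul_hatMatrix (hG : IsUnit (gram X M)) :
    rowsOf X M * hatMatrix X M = rowsOf X M := by
  rw [hatMatrix, ← Matrix.mul_assoc, ← Matrix.mul_assoc, ← gram,
    mul_nonsing_inv _ (isUnit_det_gram hG), Matrix.one_mul]

lemma hatMatrix_mul_self (hG : IsUnit (gram X M)) :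
    hatMatrix X M * hatMatrix X M = hatMatrix X M := by
  conv_lhs => rw [hatMatrix, Matrix.mul_assoc, ← hatMatrix, rowsOf_mul_hatMatrix hG]
  rw [hatMatrix]

lemma trace_hatMatrix (hG : IsUnit (gram X M)) : (hatMatrix X M).trace = M.card := by
  rw [hatMatrix, Matrix.mul_assoc, trace_mul_comm, Matrix.mul_assoc, ← gram,
    nonsing_inv_mul _ (isUnit_det_gram hG), trace_one, Fintype.card_coe]

lemma transpose_one_sub_hatMatrix : (1 - hatMatrix X M)ᵀ = 1 - hatMatrix X M := by
  rw [transpose_sub, transpose_one, transpose_hatMatrix]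

lemma one_sub_hatMatrix_mul_self (hG : IsUnit (gram X M)) :
    (1 - hatMatrix X M) * (1 - hatMatrix X M) = 1 - hatMatrix X M := by
  rw [Matrix.sub_mul, Matrix.mul_sub, Matrix.mul_sub, hatMatrix_mul_self hG]
  simp

lemma lsEstimator_mul_rowsOf (Y : Matrix (Fin q) (Fin n) ℝ) :
    lsEstimator X M Y * rowsOf X M = Y * hatMatrix X M := by
  simp only [lsEstimator, hatMatrix, Matrix.mul_assoc]

variable {B0 : Matrix (Fin q) M ℝ} {V : Matrix (Fin q) (Fin q) ℝ} {Z : Matrix (Fin q) (Fin n) ℝ}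

/-- Under the model `Y = B⁰ X_M + V^{1/2} Z` the residual matrix is a function of the residual
noise. -/
lemma rss_eq (hG : IsUnit (gram X M)) :
    rss X M (B0 * rowsOf X M + CFC.sqrt V * Z) = CFC.sqrt V *
      (Z * (1 - hatMatrix X M) * (Z * (1 - hatMatrix X M))ᵀ) * CFC.sqrt V := by
  have h1 : (B0 * rowsOf X M + CFC.sqrt V * Z) * (1 - hatMatrix X M) =
      CFC.sqrt V * (Z * (1 - hatMatrix X M)) := by
    rw [Matrix.add_mul, Matrix.mul_assoc B0, Matrix.mul_sub (rowsOf X M),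
      rowsOf_mul_hatMatrix hG, Matrix.mul_one, sub_self, Matrix.mul_zero, zero_add,
      Matrix.mul_assoc]
  set P := 1 - hatMatrix X M with hP
  have hPP : P * P = P := one_sub_hatMatrix_mul_self hG
  have hPt : Pᵀ = P := transpose_one_sub_hatMatrix
  set Y := B0 * rowsOf X M + CFC.sqrt V * Z with hY
  have h2 : rss X M Y = (Y * P) * (Y * P)ᵀ := by
    rw [rss, ← hP, transpose_mul, hPt, Matrix.mul_assoc Y P (P * Yᵀ), ← Matrix.mul_assoc P P,
      hPP, Matrix.mul_assoc]
  rw [h2, h1, transpose_mul, transpose_sqrt]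
  simp only [Matrix.mul_assoc]

lemma lsEstimator_mul_rowsOf_sub (hG : IsUnit (gram X M)) :
    lsEstimator X M (B0 * rowsOf X M + CFC.sqrt V * Z) * rowsOf X M - B0 * rowsOf X M =
      CFC.sqrt V * (Z * hatMatrix X M) := by
  rw [lsEstimator_mul_rowsOf, Matrix.add_mul, Matrix.mul_assoc B0, rowsOf_mul_hatMatrix hG,
    add_sub_cancel_left, Matrix.mul_assoc]

lemma frobSq_mul_invSqrt_gram (hG : IsUnit (gram X M)) (K : Matrix (Fin q) M ℝ) :
    frobSq (K * invSqrt (gram X M)⁻¹) = frobSq (K * rowsOf X M) := by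
  have hW : (gram X M)⁻¹.PosDef := (posDef_gram hG).inv
  rw [frobSq_eq_trace', frobSq_eq_trace', transpose_mul, transpose_mul, transpose_invSqrt,
    Matrix.mul_assoc, ← Matrix.mul_assoc (invSqrt _), invSqrt_mul_invSqrt hW,
    nonsing_inv_nonsing_inv _ (isUnit_det_gram hG), gram]
  simp only [Matrix.mul_assoc]

/-- `h_ε` is the indicator of the closed set on which no sparse fit comes within `2 ε`. -/
lemma hFun_eq_indicator {ε : ℝ} (hM : 1 ≤ M.card) (hMn : M.card + q < n)
    (Y : Matrix (Fin q) (Fin n) ℝ) :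
    hFun ε X M Y = Set.indicator {BM | ∀ B : Matrix (Fin q) (Fin p) ℝ, IsFeasible M.card B →
      2 * ε ≤ objective (rss X M Y) (BM * rowsOf X M) X B} 1 := by
  classical
  ext BM
  rw [hFun, Set.indicator_apply]
  refine if_congr ⟨?_, fun h => ⟨?_, hMn⟩⟩ rfl rfl
  · rintro ⟨⟨Bmin, ⟨-, hmin⟩, h⟩, -⟩ B hB
    linarith [hmin B hB]
  · obtain ⟨Bmin, hmin⟩ := exists_isSparseMin (rss X M Y) (BM * rowsOf X M) X hM
    refine ⟨Bmin, hmin, ?_⟩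
    have := h Bmin hmin.1
    linarith

lemma isClosed_admissible (ε : ℝ) (Y : Matrix (Fin q) (Fin n) ℝ) :
    IsClosed {BM : Matrix (Fin q) M ℝ | ∀ B : Matrix (Fin q) (Fin p) ℝ, IsFeasible M.card B →
      2 * ε ≤ objective (rss X M Y) (BM * rowsOf X M) X B} := by
  simp only [Set.ofPred_forall]
  refine isClosed_iInter fun B => isClosed_iInter fun _ => isClosed_le continuous_const ?_
  exact continuous_frobSq.comp (by fun_prop)

/-- If the noise is well behaved, every `BM` within `√(2 ε)` of the least squares fit is
`ε`-admissible. The three distances in the triangle inequality are `√(18 ε) = 3 √(2 ε)`, from the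
signal, and twice `√(2 ε)`. -/
lemma two_mul_le_objective {ε N : ℝ} (hq : 1 ≤ q) (hV : V.PosDef) (hG : IsUnit (gram X M))
    (hN : 0 < N)
    (hU : ∀ D : Matrix (Fin q) Unit ℝ,
      N / 2 * frobSq D ≤ frobSq ((Z * (1 - hatMatrix X M))ᵀ * D))
    (hU' : frobSq (Z * (1 - hatMatrix X M)) ≤ 2 * (q * N))
    (hZ : frobSq (Z * hatMatrix X M) ≤ ε * N)
    {B : Matrix (Fin q) (Fin p) ℝ}
    (hB : 36 * q * N * ε ≤ objective V (B0 * rowsOf X M) X B)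
    {BM : Matrix (Fin q) M ℝ}
    (hBM : frobSq (invSqrt (rss X M (B0 * rowsOf X M + CFC.sqrt V * Z)) *
      (BM - lsEstimator X M (B0 * rowsOf X M + CFC.sqrt V * Z)) * rowsOf X M) ≤ 2 * ε) :
    2 * ε ≤ objective (rss X M (B0 * rowsOf X M + CFC.sqrt V * Z)) (BM * rowsOf X M) X B := by
  set Y := B0 * rowsOf X M + CFC.sqrt V * Z with hY
  set S := rss X M Y with hS
  set U := Z * (1 - hatMatrix X M) with hUdef
  have hSU : S = CFC.sqrt V * (U * Uᵀ) * CFC.sqrt V := rss_eq hG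
  have hqR : (1 : ℝ) ≤ q := by exact_mod_cast hq
  have h1 : 18 * ε ≤ frobSq (invSqrt S * (B0 * rowsOf X M - B * X)) := by
    have h := frobSq_invSqrt_le hV (posDef_mul_transpose (half_pos hN) hU)
      (B0 * rowsOf X M - B * X)
    rw [← hSU] at h
    have h0 := frobSq_nonneg (invSqrt S * (B0 * rowsOf X M - B * X))
    have h2 : 36 * q * N * ε ≤ 2 * (q * N) *
        frobSq (invSqrt S * (B0 * rowsOf X M - B * X)) :=
      hB.trans (h.trans (mul_le_mul_of_nonneg_right hU' h0))
    have h3 : 0 < 2 * (q * N) := by positivity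
    refine le_of_mul_le_mul_left ?_ h3
    linarith
  have h2 : frobSq (invSqrt S * (lsEstimator X M Y * rowsOf X M - B0 * rowsOf X M)) ≤ 2 * ε := by
    have h := mul_frobSq_invSqrt_le hV (half_pos hN) hU (Z * hatMatrix X M)
    rw [← hSU] at h
    rw [hY, lsEstimator_mul_rowsOf_sub hG]
    refine le_of_mul_le_mul_left ?_ (half_pos hN)
    linarith
  set a := invSqrt S * (B0 * rowsOf X M - B * X) with ha
  set b := invSqrt S * (lsEstimator X M Y * rowsOf X M - B0 * rowsOf X M) with hb
  set c := invSqrt S * (BM - lsEstimator X M Y) * rowsOf X M with hc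
  set d := invSqrt S * (BM * rowsOf X M - B * X) with hd
  have hsum : a = d + (-b + -c) := by
    rw [ha, hb, hc, hd, Matrix.mul_assoc, ← Matrix.mul_neg, ← Matrix.mul_neg, ← Matrix.mul_add,
      ← Matrix.mul_add, Matrix.sub_mul]
    congr 1
    abel
  have h3 : √(frobSq a) ≤ √(frobSq d) + (√(frobSq b) + √(frobSq c)) := by
    rw [hsum, ← frobSq_neg b, ← frobSq_neg c]
    exact (sqrt_frobSq_add_le _ _).trans (add_le_add_right (sqrt_frobSq_add_le _ _) _)
  have h4 : 3 * √(2 * ε) ≤ √(frobSq a) := by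
    rw [show (3 : ℝ) = √(3 ^ 2) by rw [Real.sqrt_sq (by norm_num)],
      ← Real.sqrt_mul (by norm_num)]
    exact Real.sqrt_le_sqrt (by linarith)
  have h5 := Real.sqrt_le_sqrt h2
  have h6 := Real.sqrt_le_sqrt hBM
  have h7 : √(2 * ε) ≤ √(frobSq d) := by linarith
  exact (Real.sqrt_le_sqrt_iff (frobSq_nonneg d)).1 h7

/-- The fiducial expectation of `h_ε` is close to `1` whenever the noise is well behaved. -/
theorem one_sub_tTailBound_le_expectH {ε : ℝ} (hq : 1 ≤ q) (hV : V.PosDef)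
    (hG : IsUnit (gram X M)) (hM : 1 ≤ M.card) (hMn : M.card + q < n)
    (hMn' : 2 * ((q * M.card : ℕ) : ℝ) ≤ n)
    (hU : ∀ D : Matrix (Fin q) Unit ℝ,
      ((n : ℝ) - M.card) / 2 * frobSq D ≤ frobSq ((Z * (1 - hatMatrix X M))ᵀ * D))
    (hU' : frobSq (Z * (1 - hatMatrix X M)) ≤ 2 * (q * ((n : ℝ) - M.card)))
    (hZ : frobSq (Z * hatMatrix X M) ≤ ε * ((n : ℝ) - M.card))
    (hB : ∀ B : Matrix (Fin q) (Fin p) ℝ, IsFeasible M.card B →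
      36 * q * ((n : ℝ) - M.card) * ε ≤ objective V (B0 * rowsOf X M) X B) :
    1 - tTailBound n ε (q * M.card) ≤
      expectH ε X M (B0 * rowsOf X M + CFC.sqrt V * Z) := by
  have hN : 0 < (n : ℝ) - M.card := by
    have : (M.card : ℝ) < n := by exact_mod_cast (by omega : M.card < n)
    linarith
  have hn0 : (0 : ℝ) < n := by
    have : (0 : ℝ) ≤ M.card := Nat.cast_nonneg _
    linarith
  set Y := B0 * rowsOf X M + CFC.sqrt V * Z with hY
  have hS : (rss X M Y).PosDef := by
    rw [hY, rss_eq hG]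
    exact posDef_sqrt_mul_mul_sqrt hV (posDef_mul_transpose (half_pos hN) hU)
  have hW : (gram X M)⁻¹.PosDef := (posDef_gram hG).inv
  have hν : ((n : ℝ) - M.card - q + 1) + Fintype.card M + Fintype.card (Fin q) - 1 = n := by
    simp only [Fintype.card_coe, Fintype.card_fin]
    ring
  have hd : Fintype.card (Fin q) * Fintype.card M = q * M.card := by simp
  have hprob : IsProbabilityMeasure (fiducial X M Y) :=
    isProbabilityMeasure_matrixT hS hW hn0 hν (by rwa [hd]) _
  have htail := matrixT_tail_le (ε := ε) hS hW hn0 hν (by rwa [hd]) (lsEstimator X M Y)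
  rw [hd] at htail
  have hE := (isClosed_admissible (X := X) (M := M) ε Y).measurableSet
  rw [expectH, hFun_eq_indicator hM hMn, integral_indicator_one hE]
  set E := {BM : Matrix (Fin q) M ℝ | ∀ B : Matrix (Fin q) (Fin p) ℝ, IsFeasible M.card B →
    2 * ε ≤ objective (rss X M Y) (BM * rowsOf X M) X B}
  have hcompl : (fiducial X M Y).real Eᶜ ≤ tTailBound n ε (q * M.card) := by
    refine le_trans (measureReal_mono fun BM hBM => ?_) htail
    by_contra hnot
    rw [Set.mem_ofPred_eq, not_lt, frobSq_mul_invSqrt_gram hG] at hnot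
    exact hBM fun B hB' => two_mul_le_objective hq hV hG hN hU hU' hZ (hB B hB') hnot
  rw [probReal_compl_eq_one_sub hE] at hcompl
  linarith

end Design

/-! ### The Gaussian noise -/

section MatrixNormal

variable {r m : Type*} [Fintype r] [Fintype m]

/-- The matrix whose stacked columns are the given vector. -/
def unvec (v : EuclideanSpace ℝ (m × r)) : Matrix r m ℝ := Matrix.of fun i j => v (j, i)

omit [Fintype r] [Fintype m] in
lemma vec_unvec (v : EuclideanSpace ℝ (m × r)) : vec (unvec v) = v.ofLp := rfl

lemma quadForm_kronecker {P : Matrix m m ℝ} (hP : Pᵀ = P) (K : Matrix r r ℝ)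
    (v : EuclideanSpace ℝ (m × r)) :
    v.ofLp ⬝ᵥ (P ⊗ₖ K) *ᵥ v.ofLp = ((unvec v)ᵀ * K * unvec v * P).trace := by
  rw [← vec_unvec v, kronecker_mulVec_vec, vec_dotProduct_vec, hP]
  simp only [Matrix.mul_assoc]

omit [Fintype r] [Fintype m] in
lemma isHermitian_kronecker {P : Matrix m m ℝ} (hP : Pᵀ = P) {K : Matrix r r ℝ} (hK : Kᵀ = K) :
    (P ⊗ₖ K).IsHermitian := by
  rw [IsHermitian, conjTranspose_kronecker, conjTranspose_eq_transpose_of_trivial,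
    conjTranspose_eq_transpose_of_trivial, hP, hK]

variable {P : Matrix m m ℝ}

lemma frobSq_transpose_unvec_mul (hP : Pᵀ = P) (hPP : P * P = P) (D : Matrix r Unit ℝ)
    (v : EuclideanSpace ℝ (m × r)) :
    frobSq ((unvec v * P)ᵀ * D) = v.ofLp ⬝ᵥ (P ⊗ₖ (D * Dᵀ)) *ᵥ v.ofLp := by
  rw [quadForm_kronecker hP, frobSq_eq_trace']
  simp only [transpose_mul, transpose_transpose, hP, Matrix.mul_assoc]
  rw [trace_mul_comm]
  simp only [Matrix.mul_assoc, hPP]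

variable [DecidableEq r] [DecidableEq m]

lemma sqrt_one_kronecker {V : Matrix r r ℝ} (hV : V.PosDef) :
    CFC.sqrt ((1 : Matrix m m ℝ) ⊗ₖ V) = (1 : Matrix m m ℝ) ⊗ₖ CFC.sqrt V := by
  refine CFC.sqrt_unique ?_ ?_
  · rw [← mul_kronecker_mul, Matrix.one_mul, sqrt_mul_sqrt hV]
  · exact (PosSemidef.one.kronecker (nonneg_iff_posSemidef.1 (CFC.sqrt_nonneg V))).nonneg

/-- A matrix normal variable with independent columns is `A + V^{1/2} Z`, with `Z` standard. -/
lemma matrixNormal_one_eq (A : Matrix r m ℝ) {V : Matrix r r ℝ} (hV : V.PosDef) :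
    matrixNormal A V (1 : Matrix m m ℝ) =
      (stdGaussian (EuclideanSpace ℝ (m × r))).map fun v => A + CFC.sqrt V * unvec v := by
  have hm : Measurable fun v : EuclideanSpace ℝ (m × r) =>
      (Matrix.of fun i j => v (j, i) : Matrix r m ℝ) :=
    Continuous.measurable (by fun_prop)
  rw [matrixNormal, multivariateGaussian, Measure.map_map hm (by fun_prop)]
  congr 1
  ext v i j
  have h1 : ((1 : Matrix m m ℝ) ⊗ₖ CFC.sqrt V) *ᵥ v.ofLp = vec (CFC.sqrt V * unvec v) := by
    rw [← vec_unvec v, kronecker_mulVec_vec, transpose_one, Matrix.mul_one]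
  have h2 := congrFun h1 (j, i)
  simp only [Function.comp_apply, of_apply, PiLp.add_apply, Matrix.add_apply,
    sqrt_one_kronecker hV, ofLp_toEuclideanCLM, h2]
  rfl

omit [DecidableEq m] in
lemma frobSq_unvec_mul (hP : Pᵀ = P) (hPP : P * P = P) (v : EuclideanSpace ℝ (m × r)) :
    frobSq (unvec v * P) = v.ofLp ⬝ᵥ (P ⊗ₖ (1 : Matrix r r ℝ)) *ᵥ v.ofLp := by
  rw [quadForm_kronecker hP, frobSq_eq_trace, transpose_mul, hP, Matrix.mul_one, Matrix.mul_assoc,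
    trace_mul_comm]
  simp only [Matrix.mul_assoc, hPP]

/-- `‖Z P‖²` is chi-squared with `card r * tr P` degrees of freedom, for a projection `P`. -/
lemma measureReal_le_frobSq_unvec_mul (hP : Pᵀ = P) (hPP : P * P = P) (s : ℝ) :
    (stdGaussian (EuclideanSpace ℝ (m × r))).real {v | s ≤ frobSq (unvec v * P)} ≤
      Real.exp (-s / 4 + Real.log 2 / 2 * (P.trace * Fintype.card r)) := by
  have h := measureReal_le_quadForm (isHermitian_kronecker hP (transpose_one (n := r) (α := ℝ)))
    (by rw [← mul_kronecker_mul, hPP, Matrix.one_mul]) s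
  rw [trace_kronecker, trace_one] at h
  simpa only [frobSq_unvec_mul hP hPP] using h

/-- `‖(Z P)ᵀ u‖²` is chi-squared with `tr P` degrees of freedom, for a projection `P` and a unit
vector `u`. -/
lemma measureReal_frobSq_transpose_unvec_mul_le (hP : Pᵀ = P) (hPP : P * P = P)
    (htr : 0 ≤ P.trace) {u : Matrix r Unit ℝ} (hu : frobSq u = 1) :
    (stdGaussian (EuclideanSpace ℝ (m × r))).real
      {v | frobSq ((unvec v * P)ᵀ * u) ≤ 0.6 * P.trace} ≤ Real.exp (-0.05 * P.trace) := by
  have huu : uᵀ * u = 1 := by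
    ext i j
    have h := frobSq_eq_trace u
    rw [hu, trace, Fintype.sum_unique] at h
    simpa using h.symm
  have htr' : (P ⊗ₖ (u * uᵀ)).trace = P.trace := by
    rw [trace_kronecker, ← frobSq_eq_trace', hu, mul_one]
  have h := measureReal_quadForm_le (T := P ⊗ₖ (u * uᵀ))
    (isHermitian_kronecker hP (by rw [transpose_mul, transpose_transpose]))
    (by rw [← mul_kronecker_mul, hPP, Matrix.mul_assoc, ← Matrix.mul_assoc uᵀ, huu,
      Matrix.one_mul]) (by rwa [htr'])
  rw [htr'] at h
  simpa only [frobSq_transpose_unvec_mul hP hPP] using h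

end MatrixNormal

section Net

variable {r m : Type*} [Fintype r] [Fintype m]

section

attribute [local instance] Matrix.frobeniusNormedAddCommGroup Matrix.frobeniusNormedSpace

/-- The unit sphere has finite nets. -/
lemma exists_finset_net (r : Type*) [Fintype r] {δ : ℝ} (hδ : 0 < δ) :
    ∃ s : Finset (Matrix r Unit ℝ), (∀ u ∈ s, frobSq u = 1) ∧
      ∀ D : Matrix r Unit ℝ, frobSq D = 1 → ∃ u ∈ s, √(frobSq (u - D)) ≤ δ := by
  have hprop : ProperSpace (Matrix r Unit ℝ) := FiniteDimensional.proper_real _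
  obtain ⟨t, ht, hfin, hcov⟩ :=
    (isCompact_sphere (0 : Matrix r Unit ℝ) 1).finite_cover_balls hδ
  refine ⟨hfin.toFinset, fun u hu => ?_, fun D hD => ?_⟩
  · have h := ht (hfin.mem_toFinset.1 hu)
    rw [mem_sphere_zero_iff_norm, ← sqrt_frobSq_eq_norm, Real.sqrt_eq_one] at h
    exact h
  · have h : D ∈ Metric.sphere (0 : Matrix r Unit ℝ) 1 := by
      rw [mem_sphere_zero_iff_norm, ← sqrt_frobSq_eq_norm, hD, Real.sqrt_one]
    obtain ⟨u, hu, hDu⟩ := Set.mem_iUnion₂.1 (hcov h)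
    refine ⟨u, hfin.mem_toFinset.2 hu, ?_⟩
    rw [sqrt_frobSq_eq_norm, ← dist_eq_norm, dist_comm]
    exact (Metric.mem_ball.1 hDu).le

end

/-- A lower bound `0.6 N` for `‖Uᵀ u‖²` on a sufficiently fine net yields the bound `N / 2` on the
whole sphere, because `√0.6 - 1 / 20 ≥ √0.5`. -/
lemma half_mul_frobSq_le_of_net {U : Matrix r m ℝ} {c N : ℝ} (hc : 0 < c) (hN : 0 < N)
    {s : Finset (Matrix r Unit ℝ)}
    (hs : ∀ D : Matrix r Unit ℝ, frobSq D = 1 → ∃ u ∈ s, √(frobSq (u - D)) ≤ 1 / (20 * √c))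
    (hU : frobSq U ≤ c * N) (hlow : ∀ u ∈ s, 0.6 * N ≤ frobSq (Uᵀ * u)) (D : Matrix r Unit ℝ) :
    N / 2 * frobSq D ≤ frobSq (Uᵀ * D) := by
  have hsc : 0 < √c := Real.sqrt_pos.2 hc
  have hunit : ∀ D : Matrix r Unit ℝ, frobSq D = 1 → N / 2 ≤ frobSq (Uᵀ * D) := by
    intro D hD
    obtain ⟨u, hu, huD⟩ := hs D hD
    have h1 : √(frobSq (Uᵀ * (u - D))) ≤ √N / 20 := by
      calc √(frobSq (Uᵀ * (u - D))) ≤ √(frobSq U * frobSq (u - D)) := by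
            refine Real.sqrt_le_sqrt ?_
            rw [← frobSq_transpose U]
            exact frobSq_mul_le _ _
        _ = √(frobSq U) * √(frobSq (u - D)) := Real.sqrt_mul (frobSq_nonneg U) _
        _ ≤ √(c * N) * (1 / (20 * √c)) :=
            mul_le_mul (Real.sqrt_le_sqrt hU) huD (Real.sqrt_nonneg _) (Real.sqrt_nonneg _)
        _ = √N / 20 := by
            rw [Real.sqrt_mul hc.le]
            field_simp
    have h2 : √(frobSq (Uᵀ * u)) ≤ √(frobSq (Uᵀ * D)) + √(frobSq (Uᵀ * (u - D))) := by
      have h := sqrt_frobSq_add_le (Uᵀ * D) (Uᵀ * (u - D))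
      rwa [← Matrix.mul_add, add_sub_cancel] at h
    have h3 : 0.774 * √N ≤ √(frobSq (Uᵀ * u)) := by
      refine Real.le_sqrt_of_sq_le ?_
      rw [mul_pow, Real.sq_sqrt hN.le]
      linarith [hlow u hu]
    have h4 : 0.724 * √N ≤ √(frobSq (Uᵀ * D)) := by linarith
    have h5 := pow_le_pow_left₀ (by positivity) h4 2
    rw [mul_pow, Real.sq_sqrt hN.le, Real.sq_sqrt (frobSq_nonneg _)] at h5
    linarith
  by_cases hD : D = 0
  · subst hD
    simp [frobSq]
  · have hpos := frobSq_pos hD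
    have h := hunit ((√(frobSq D))⁻¹ • D) (by
      rw [frobSq_smul, inv_pow, Real.sq_sqrt hpos.le, inv_mul_cancel₀ hpos.ne'])
    rw [Matrix.mul_smul, frobSq_smul, inv_pow, Real.sq_sqrt hpos.le, ← div_eq_inv_mul,
      le_div_iff₀ hpos] at h
    exact h

end Net

/-! ### Sample sizes -/

section Asymptotics

lemma eventually_rpow_mul_log_le {α : ℝ} (hα : α < 1) {c : ℝ} (hc : 0 < c) :
    ∀ᶠ x : ℝ in Filter.atTop, x ^ α * (2 + Real.log x) ≤ c * x := by
  have h1 : (fun x : ℝ => x ^ α * (2 + Real.log x)) =o[Filter.atTop]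
      fun x : ℝ => x ^ α * x ^ (1 - α) := by
    refine (Asymptotics.isBigO_refl _ _).mul_isLittleO (Asymptotics.IsLittleO.add ?_ ?_)
    · exact Asymptotics.isLittleO_const_left.2 (Or.inr
        (tendsto_norm_atTop_atTop.comp (tendsto_rpow_atTop (by linarith))))
    · exact isLittleO_log_rpow_atTop (by linarith)
  filter_upwards [h1.bound hc, Filter.eventually_gt_atTop 0] with x hx hx0
  have h2 : x ^ α * x ^ (1 - α) = x := by
    rw [← Real.rpow_add hx0]
    simp
  rw [h2, Real.norm_of_nonneg hx0.le] at hx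
  exact (le_abs_self _).trans hx

/-- Each summand of `tTailBound` is at most the corresponding summand of the error term in the
theorem; the number `d` of entries of the coefficient matrix is small compared with
`n / log n`. -/
lemma tTailBound_le {n k q ε : ℝ} {d : ℕ} (hn : 1 ≤ n) (hk : 0 ≤ k) (hkn : k ≤ n) (hq : 0 ≤ q)
    (hε : 0 < ε) (hd : (d : ℝ) = q * k) (hdn : d * (2 + Real.log n) ≤ n / 10)
    (hqn : q ≤ n / 10) :
    tTailBound n ε d ≤ Real.exp (-(ε * (n - k)) / 36 + q * k / 2) +
      2 * Real.exp (-(1 / 8) * (√(n - k) - 2 * √q) ^ 2) := by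
  have hn0 : 0 < n := by linarith
  have hpi := Real.pi_pos
  refine add_le_add (Real.exp_le_exp.2 ?_) ?_
  · rw [hd]
    nlinarith [mul_nonneg hε.le hk, mul_pos hε hn0]
  · have h1 : (√(n - k) - 2 * √q) ^ 2 ≤ n + 4 * q := by
      nlinarith [Real.sq_sqrt (sub_nonneg.2 hkn), Real.sq_sqrt hq, Real.sqrt_nonneg (n - k),
        Real.sqrt_nonneg q, mul_nonneg (Real.sqrt_nonneg (n - k)) (Real.sqrt_nonneg q)]
    have h2 : √(Real.pi * n / 2) ^ d = Real.exp (d * (Real.log (Real.pi * n / 2) / 2)) := by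
      rw [Real.exp_nat_mul, ← Real.log_sqrt (by positivity), Real.exp_log (by positivity)]
    have h3 : Real.log (Real.pi * n / 2) ≤ 1 + Real.log n := by
      rw [show Real.pi * n / 2 = Real.pi / 2 * n by ring, Real.log_mul (by positivity) hn0.ne']
      have h := Real.log_le_sub_one_of_pos (show 0 < Real.pi / 2 by positivity)
      linarith [Real.pi_lt_four]
    have h4 : 2 ^ ((d : ℝ) - n / 2) = Real.exp (Real.log 2 * (d - n / 2)) :=
      Real.rpow_def_of_pos (by norm_num) _
    have h5 := Real.log_nonneg hn
    have hd0 : (0 : ℝ) ≤ d := Nat.cast_nonneg _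
    have h6 : (d : ℝ) * (Real.log (Real.pi * n / 2) / 2) ≤ d * ((1 + Real.log n) / 2) :=
      mul_le_mul_of_nonneg_left (by linarith) hd0
    have hl1 := Real.log_two_gt_d9
    have hl2 := Real.log_two_lt_d9
    rw [h2, h4, ← Real.exp_add]
    refine le_trans (Real.exp_le_exp.2 ?_)
      (le_mul_of_one_le_left (Real.exp_pos _).le (by norm_num : (1 : ℝ) ≤ 2))
    nlinarith [mul_nonneg hd0 h5, mul_le_mul_of_nonneg_right hl1.le hn0.le,
      mul_le_mul_of_nonneg_right hl2.le hd0]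

/-- The requirements on the sample size `n`, for a model of size `k < n ^ α` and a net of `c`
points. -/
lemma exists_sample_size (q c : ℕ) {α : ℝ} (hα : α < 1) :
    ∃ n₀ : ℕ, ∀ n : ℕ, n₀ ≤ n → ∀ k : ℕ, (k : ℝ) < (n : ℝ) ^ α →
      k + q < n ∧ 2 * ((q * k : ℕ) : ℝ) ≤ n ∧
      c * Real.exp (-0.05 * ((n : ℝ) - k)) ≤ Real.exp (-0.04 * ((n : ℝ) - k)) ∧
      ∀ ε : ℝ, 0 < ε → tTailBound n ε (q * k) ≤
        Real.exp (-(ε * ((n : ℝ) - k)) / 36 + (q : ℝ) * k / 2) +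
          2 * Real.exp (-(1 / 8) * (√((n : ℝ) - k) - 2 * √q) ^ 2) := by
  have hq0 : (0 : ℝ) ≤ q := Nat.cast_nonneg _
  have h1 := tendsto_natCast_atTop_atTop (R := ℝ) |>.eventually
    (eventually_rpow_mul_log_le hα (show 0 < 1 / (10 * ((q : ℝ) + 1)) by positivity))
  have h2 := tendsto_natCast_atTop_atTop (R := ℝ) |>.eventually
    (Filter.eventually_ge_atTop
      (max (1 : ℝ) (max (10 * ((q : ℝ) + 1)) (200 * Real.log (max (c : ℝ) 1)))))
  obtain ⟨n₀, hn₀⟩ := Filter.eventually_atTop.1 (h1.and h2)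
  refine ⟨n₀, fun n hn k hk => ?_⟩
  obtain ⟨h1, h2⟩ := hn₀ n hn
  have hn1 : (1 : ℝ) ≤ n := (le_max_left _ _).trans h2
  have hnq : 10 * ((q : ℝ) + 1) ≤ n := (le_max_left _ _).trans ((le_max_right _ _).trans h2)
  have hnc : 200 * Real.log (max (c : ℝ) 1) ≤ n := (le_max_right _ _).trans ((le_max_right _ _).trans h2)
  have hlog := Real.log_nonneg hn1
  have hk0 : (0 : ℝ) ≤ k := Nat.cast_nonneg _
  have h3 : (q + 1) * (k * (2 + Real.log n)) ≤ (n : ℝ) / 10 := by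
    have h : (k : ℝ) * (2 + Real.log n) ≤ 1 / (10 * ((q : ℝ) + 1)) * n :=
      (mul_le_mul_of_nonneg_right hk.le (by linarith)).trans h1
    have h' := mul_le_mul_of_nonneg_left h (by linarith : (0 : ℝ) ≤ q + 1)
    refine h'.trans (le_of_eq ?_)
    field_simp
  have hkl : 0 ≤ (k : ℝ) * Real.log n := mul_nonneg hk0 hlog
  have hqk : 0 ≤ (q : ℝ) * k := mul_nonneg hq0 hk0
  have hqkl : 0 ≤ (q : ℝ) * (k * Real.log n) := mul_nonneg hq0 hkl
  have hkn : (k : ℝ) ≤ n / 20 := by nlinarith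
  have hd : ((q * k : ℕ) : ℝ) = q * k := by push_cast; ring
  refine ⟨?_, ?_, ?_, fun ε hε => ?_⟩
  · have : (k : ℝ) + q < n := by linarith
    exact_mod_cast this
  · rw [hd]
    nlinarith
  · have hc1 : (1 : ℝ) ≤ max (c : ℝ) 1 := le_max_right _ _
    calc (c : ℝ) * Real.exp (-0.05 * ((n : ℝ) - k))
        ≤ Real.exp (Real.log (max (c : ℝ) 1)) * Real.exp (-0.05 * ((n : ℝ) - k)) := by
          rw [Real.exp_log (by linarith)]
          exact mul_le_mul_of_nonneg_right (le_max_left _ _) (Real.exp_pos _).le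
      _ ≤ Real.exp (-0.04 * ((n : ℝ) - k)) := by
          rw [← Real.exp_add]
          exact Real.exp_le_exp.2 (by linarith)
  · refine tTailBound_le hn1 hk0 (by linarith) hq0 hε hd ?_ (by linarith)
    rw [hd]
    nlinarith

end Asymptotics

section Eigenvalues

variable {q : ℕ} {V : Matrix (Fin q) (Fin q) ℝ}

lemma lambdaMin_le_lambdaMax (hq : 1 ≤ q) (hV : V.IsHermitian) :
    lambdaMin hV ≤ lambdaMax hV :=
  (ciInf_le (Set.finite_range _).bddBelow ⟨0, hq⟩).trans
    (le_ciSup (Set.finite_range hV.eigenvalues).bddAbove ⟨0, hq⟩)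

lemma lambdaMax_pos (hq : 1 ≤ q) (hV : V.PosDef) : 0 < lambdaMax hV.isHermitian :=
  (hV.eigenvalues_pos ⟨0, hq⟩).trans_le
    (le_ciSup (Set.finite_range hV.isHermitian.eigenvalues).bddAbove ⟨0, hq⟩)

end Eigenvalues

section NoiseEvents

variable {q n p : ℕ} {X : Matrix (Fin p) (Fin n) ℝ} {M : Finset (Fin p)}

lemma trace_one_sub_hatMatrix (hG : IsUnit (gram X M)) :
    (1 - hatMatrix X M).trace = (n : ℝ) - M.card := by
  rw [trace_sub, trace_one, trace_hatMatrix hG, Fintype.card_fin]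

lemma measureReal_residual_large_le (q : ℕ) (hG : IsUnit (gram X M)) (hM : M.card ≤ n) :
    (stdGaussian (EuclideanSpace ℝ (Fin n × Fin q))).real
      {v | 2 * (q * ((n : ℝ) - M.card)) ≤ frobSq (unvec v * (1 - hatMatrix X M))} ≤
      Real.exp (-0.15 * q * ((n : ℝ) - M.card)) := by
  refine (measureReal_le_frobSq_unvec_mul transpose_one_sub_hatMatrix
    (one_sub_hatMatrix_mul_self hG) _).trans (Real.exp_le_exp.2 ?_)
  rw [trace_one_sub_hatMatrix hG, Fintype.card_fin]
  have h1 : (M.card : ℝ) ≤ n := by exact_mod_cast hM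
  have h2 : 0 ≤ (q : ℝ) * ((n : ℝ) - M.card) := mul_nonneg (Nat.cast_nonneg _) (by linarith)
  nlinarith [Real.log_two_lt_d9, mul_le_mul_of_nonneg_right Real.log_two_lt_d9.le h2]

lemma measureReal_fit_large_le (hq : 1 ≤ q) (hG : IsUnit (gram X M)) (hM : M.card ≤ n)
    {V : Matrix (Fin q) (Fin q) ℝ} (hV : V.PosDef) {ε : ℝ} (hε : 0 < ε) :
    (stdGaussian (EuclideanSpace ℝ (Fin n × Fin q))).real
      {v | ε * ((n : ℝ) - M.card) ≤ frobSq (unvec v * hatMatrix X M)} ≤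
      Real.exp (-(ε * ((n : ℝ) - M.card) * lambdaMin hV.isHermitian) /
        (4 * lambdaMax hV.isHermitian) + q * M.card / 2) := by
  refine (measureReal_le_frobSq_unvec_mul transpose_hatMatrix (hatMatrix_mul_self hG) _).trans
    (Real.exp_le_exp.2 (add_le_add ?_ ?_))
  · have h1 : (M.card : ℝ) ≤ n := by exact_mod_cast hM
    have h2 : 0 ≤ ε * ((n : ℝ) - M.card) := mul_nonneg hε.le (by linarith)
    have h3 := lambdaMax_pos hq hV
    rw [div_le_div_iff₀ (by norm_num) (by linarith)]
    nlinarith [mul_le_mul_of_nonneg_left (lambdaMin_le_lambdaMax hq hV.isHermitian) h2]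
  · rw [trace_hatMatrix hG, Fintype.card_fin]
    have h4 : 0 ≤ (M.card : ℝ) * q := by positivity
    nlinarith [mul_le_mul_of_nonneg_right Real.log_two_lt_d9.le h4]

lemma measureReal_net_small_le (hG : IsUnit (gram X M)) (hM : M.card ≤ n)
    {s : Finset (Matrix (Fin q) Unit ℝ)} (hs : ∀ u ∈ s, frobSq u = 1) :
    (stdGaussian (EuclideanSpace ℝ (Fin n × Fin q))).real
      (⋃ u ∈ s, {v | frobSq ((unvec v * (1 - hatMatrix X M))ᵀ * u) ≤
        0.6 * ((n : ℝ) - M.card)}) ≤ s.card * Real.exp (-0.05 * ((n : ℝ) - M.card)) := by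
  refine (measureReal_biUnion_finset_le s _).trans ?_
  rw [← nsmul_eq_mul, ← Finset.sum_const]
  refine Finset.sum_le_sum fun u hu => ?_
  have h1 : (M.card : ℝ) ≤ n := by exact_mod_cast hM
  have h := measureReal_frobSq_transpose_unvec_mul_le (r := Fin q) transpose_one_sub_hatMatrix
    (one_sub_hatMatrix_mul_self hG) (by rw [trace_one_sub_hatMatrix hG]; linarith) (hs u hu)
  rwa [trace_one_sub_hatMatrix hG] at h

end NoiseEvents

end EAS

theorem theorem2 (q : ℕ) (hq : 1 ≤ q) (α : ℝ) (hα0 : 0 < α) (hα1 : α < 1) :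
    ∃ n₀ : ℕ, ∀ n : ℕ, n₀ ≤ n →
      ∀ (p : ℕ) (X : Matrix (Fin p) (Fin n) ℝ) (Mo : Finset (Fin p))
        (B0 : Matrix (Fin q) Mo ℝ) (V0 : Matrix (Fin q) (Fin q) ℝ) (hV0 : V0.PosDef) (ε : ℝ),
        IsUnit (EAS.gram X Mo) →
        0 < ε →
        EAS.AdmissibilityCondition α ε X Mo B0 V0 →
        1 - EAS.V3 q n Mo.card ε
              (EAS.lambdaMin hV0.isHermitian) (EAS.lambdaMax hV0.isHermitian) ≤
          (EAS.matrixNormal (B0 * EAS.rowsOf X Mo) V0 (1 : Matrix (Fin n) (Fin n) ℝ)).real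
            {Y : Matrix (Fin q) (Fin n) ℝ |
              1 - Real.exp (-(ε * ((n : ℝ) - Mo.card)) / 36 + (q : ℝ) * Mo.card / 2)
                  - 2 * Real.exp (-(1 / 8) *
                      (Real.sqrt ((n : ℝ) - Mo.card) - 2 * Real.sqrt q) ^ 2) ≤
                EAS.expectH ε X Mo Y} := by
  have hqR : (1 : ℝ) ≤ q := by exact_mod_cast hq
  have hc : (0 : ℝ) < 2 * q := by linarith
  obtain ⟨s, hs1, hs⟩ := EAS.exists_finset_net (Fin q)
    (show 0 < 1 / (20 * √(2 * (q : ℝ))) by positivity)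
  obtain ⟨n₀, hn₀⟩ := EAS.exists_sample_size q s.card hα1
  refine ⟨n₀, fun n hn p X Mo B0 V0 hV0 ε hG hε hadm => ?_⟩
  obtain ⟨hcard, Bmin, ⟨hfeas, hmin⟩, hεB⟩ := hadm
  obtain ⟨hkn, hdn, hnet, htail⟩ := hn₀ n hn Mo.card hcard
  have hM : 1 ≤ Mo.card := by
    rw [EAS.IsFeasible] at hfeas
    omega
  have hMn : Mo.card ≤ n := by omega
  have hN : 0 < (n : ℝ) - Mo.card := by
    have : (Mo.card : ℝ) < n := by exact_mod_cast (by omega : Mo.card < n)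
    linarith
  have hB : ∀ B : Matrix (Fin q) (Fin p) ℝ, EAS.IsFeasible Mo.card B →
      36 * q * ((n : ℝ) - Mo.card) * ε ≤ EAS.objective V0 (B0 * EAS.rowsOf X Mo) X B := by
    intro B hBf
    have h0 : 0 < 36 * q * ((n : ℝ) - Mo.card) := by positivity
    rw [one_div, inv_mul_eq_div, lt_div_iff₀' h0] at hεB
    exact hεB.le.trans (hmin B hBf)
  set μ := stdGaussian (EuclideanSpace ℝ (Fin n × Fin q)) with hμ
  let f : EuclideanSpace ℝ (Fin n × Fin q) → Matrix (Fin q) (Fin n) ℝ :=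
    fun v => B0 * EAS.rowsOf X Mo + CFC.sqrt V0 * EAS.unvec v
  have hf : Measurable f := Continuous.measurable (by unfold f EAS.unvec; fun_prop)
  rw [EAS.matrixNormal_one_eq _ hV0]
  set G := {Y : Matrix (Fin q) (Fin n) ℝ |
    1 - Real.exp (-(ε * ((n : ℝ) - Mo.card)) / 36 + (q : ℝ) * Mo.card / 2)
      - 2 * Real.exp (-(1 / 8) * (Real.sqrt ((n : ℝ) - Mo.card) - 2 * Real.sqrt q) ^ 2) ≤
        EAS.expectH ε X Mo Y} with hGdef
  -- `G` need not be known to be measurable: outer measure suffices for a lower bound.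
  have hmap : μ.real (f ⁻¹' G) ≤ (μ.map f).real G := by
    have : IsProbabilityMeasure (μ.map f) := Measure.isProbabilityMeasure_map hf.aemeasurable
    exact ENNReal.toReal_mono (measure_ne_top _ _) (Measure.le_map_apply hf.aemeasurable G)
  refine le_trans ?_ hmap
  set E1 := {v : EuclideanSpace ℝ (Fin n × Fin q) | ε * ((n : ℝ) - Mo.card) ≤
    EAS.frobSq (EAS.unvec v * EAS.hatMatrix X Mo)} with hE1
  set E2 := ⋃ u ∈ s, {v : EuclideanSpace ℝ (Fin n × Fin q) |
    EAS.frobSq ((EAS.unvec v * (1 - EAS.hatMatrix X Mo))ᵀ * u) ≤ 0.6 * ((n : ℝ) - Mo.card)}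
    with hE2
  set E3 := {v : EuclideanSpace ℝ (Fin n × Fin q) | 2 * (q * ((n : ℝ) - Mo.card)) ≤
    EAS.frobSq (EAS.unvec v * (1 - EAS.hatMatrix X Mo))} with hE3
  have hcover : Set.univ ⊆ f ⁻¹' G ∪ (E1 ∪ E2 ∪ E3) := by
    intro v _
    by_contra hv
    simp only [Set.mem_union, not_or] at hv
    obtain ⟨hvG, ⟨hv1, hv2⟩, hv3⟩ := hv
    rw [hE1, Set.mem_ofPred_eq, not_le] at hv1
    rw [hE3, Set.mem_ofPred_eq, not_le] at hv3
    rw [hE2, Set.mem_iUnion₂] at hv2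
    have hlow : ∀ u ∈ s, 0.6 * ((n : ℝ) - Mo.card) ≤
        EAS.frobSq ((EAS.unvec v * (1 - EAS.hatMatrix X Mo))ᵀ * u) := fun u hu => by
      by_contra hcon
      exact hv2 ⟨u, hu, (not_le.1 hcon).le⟩
    have hU := EAS.half_mul_frobSq_le_of_net hc hN hs (by linarith) hlow
    have h := EAS.one_sub_tTailBound_le_expectH (B0 := B0) hq hV0 hG hM hkn hdn hU hv3.le hv1.le hB
    refine hvG ?_
    change _ ≤ EAS.expectH ε X Mo (f v)
    have := htail ε hε
    linarith
  have hsum : 1 ≤ μ.real (f ⁻¹' G) + (μ.real E1 + μ.real E2 + μ.real E3) := by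
    calc (1 : ℝ) = μ.real Set.univ := probReal_univ.symm
      _ ≤ μ.real (f ⁻¹' G ∪ (E1 ∪ E2 ∪ E3)) := measureReal_mono hcover
      _ ≤ _ := (measureReal_union_le _ _).trans (add_le_add_right
          ((measureReal_union_le _ _).trans (add_le_add_left (measureReal_union_le _ _) _)) _)
  have h1 : μ.real E1 ≤ _ := EAS.measureReal_fit_large_le hq hG hMn hV0 hε
  have h2 : μ.real E2 ≤ _ := (EAS.measureReal_net_small_le hG hMn hs1).trans hnet
  have h3 : μ.real E3 ≤ _ := EAS.measureReal_residual_large_le q hG hMn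
  rw [EAS.V3]
  linarith
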